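/- For a probability distribution $\mathcal D$ of $(v,y)$ on $[0,1]\times\{0,1\}$, the lower distance to calibration is $\underline{\mathsf{dCE}}(\mathcal D):=\inf_{\Pi}\mathbb E_{(u,v,y)\sim\Pi}|u-v|$, the infimum over all distributions $\Pi$ of $(u,v,y)$ on $[0,1]\times[0,1]\times\{0,1\}$ under which $(v,y)$ has law $\mathcal D$ and $\mathbb E_\Pi[y\mid u]=u$ almost surely. For $\varepsilon\in[0,1]$, a (possibly randomized) decision rule solves the $\varepsilon$-calibration testing problem with $n$ samples if, for every $\mathcal D$, given $n$ i.i.d. draws from $\mathcal D$, it answers "no" with probability at least $\frac23$ when $\underline{\mathsf{dCE}}(\mathcal D)\ge\varepsilon$, and "yes" with probability at least $\frac23$ when $\underline{\mathsf{dCE}}(\mathcal D)=0$. For $n\ge1$ let $\varepsilon_n$ be the infimum of the $\varepsilon\in(0,1)$ for which some decision rule, of any computational cost, solves the $\varepsilon$-calibration testing problem with $n$ samples. Then $\varepsilon_n\in(0,1)$ for all $n\ge1$, and there are universal constants $0<c\le C$, numbers $\varepsilon(n)\in[0,1]$ with $c\,\varepsilon_n\le\varepsilon(n)\le C\,\varepsilon_n$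 for all $n\ge1$, and a single deterministic algorithm $\mathcal A$ (a program for the real RAM, with unit-cost exact arithmetic and comparisons on real numbers, rational constants, no rounding of reals, and integer words and addresses of $O(\log n)$ bits) such that, for every $n\ge1$, $\mathcal A$ run on $n$ samples solves the $\varepsilon(n)$-calibration testing problem with $n$ samples, and the worst-case running time of $\mathcal A$ over all inputs of $n$ samples is finite for each $n\ge1$ and $O(n\log^2 n)$ as $n\to\infty$. -/

import Mathlib

open MeasureTheory ProbabilityTheory
open scoped ENNReal unitInterval

/-! Calibration testing -/

/-- A prediction-outcome pair `(v, y)` in `[0,1] × {0,1}`; the outcome `1` is `true`. -/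
abbrev Sample : Type := I × Bool

/-- The outcome as a real number, `0` or `1`. -/
def outcome (y : Bool) : ℝ := if y then 1 else 0

/-- A distribution of `(u, y)` on `[0,1] × {0,1}` is perfectly calibrated: `E[y | u] = u`
almost surely, with the conditional expectation given the σ-algebra generated by `u`. -/
def IsCalibrated (P : Measure Sample) : Prop :=
  P[fun p : Sample => outcome p.2 | MeasurableSpace.comap (Prod.fst : Sample → I) inferInstance]
    =ᵐ[P] fun p => (p.1 : ℝ)

/-- `ext(D)`: the joint distributions of `(u, v, y)` on `[0,1] × [0,1] × {0,1}` such that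
`(v, y)` has law `D` and `(u, y)` is perfectly calibrated. -/
def calibratedExtensions (D : Measure Sample) : Set (Measure (I × I × Bool)) :=
  {Q | IsProbabilityMeasure Q ∧ Q.map (fun p => p.2) = D ∧
    IsCalibrated (Q.map fun p => (p.1, p.2.2))}

/-- The lower distance to calibration of `D`: the infimum of `E |u - v|` over `ext(D)`. -/
noncomputable def lowerDistCal (D : Measure Sample) : ℝ :=
  sInf ((fun Q : Measure (I × I × Bool) => ∫ p, |(p.1 : ℝ) - (p.2.1 : ℝ)| ∂Q) ''
    calibratedExtensions D)

/-- The (possibly randomized) decision rule `κ`, which maps `n` samples to the law of its answer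
(`true` is "yes", `false` is "no"), solves the `ε`-calibration testing problem: on `n` i.i.d. draws
from `D` it answers, with probability at least `2/3`, "no" if the lower distance to calibration
of `D` is at least `ε`, and "yes" if it is zero. -/
def SolvesCalibrationTesting (n : ℕ) (ε : ℝ) (κ : Kernel (Fin n → Sample) Bool) : Prop :=
  ∀ D : Measure Sample, IsProbabilityMeasure D →
    (ε ≤ lowerDistCal D →
      (2 / 3 : ℝ≥0∞) ≤ ((Measure.pi fun _ : Fin n => D).bind κ) {false}) ∧
    (lowerDistCal D = 0 →
      (2 / 3 : ℝ≥0∞) ≤ ((Measure.pi fun _ : Fin n => D).bind κ) {true})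

/-- The information-theoretic threshold `ε_n`: the infimum of the `ε ∈ (0,1)` for which some
decision rule, without any restriction on its computational cost, solves the `ε`-calibration
testing problem with `n` samples. -/
noncomputable def testingThreshold (n : ℕ) : ℝ :=
  sInf {ε : ℝ | ε ∈ Set.Ioo (0 : ℝ) 1 ∧
    ∃ κ : Kernel (Fin n → Sample) Bool, IsMarkovKernel κ ∧ SolvesCalibrationTesting n ε κ}

/-! The real RAM with words of bounded length, programmed by `while`-programs -/

namespace RealRAM

/-- A state: word registers, real registers, and word arrays and real arrays (the first argument
is the name of the array, the second the address in it). A program names registers and arrays by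
literals, so it uses finitely many of them. -/
structure State where
  wreg : ℕ → ℕ
  rreg : ℕ → ℝ
  warr : ℕ → ℕ → ℕ
  rarr : ℕ → ℕ → ℝ

inductive WordOp
  | add | sub | mul | div | mod

/-- Subtraction of words is truncated at `0`; a quotient by `0` is `0`. -/
def WordOp.eval : WordOp → ℕ → ℕ → ℕ
  | .add, a, b => a + b
  | .sub, a, b => a - b
  | .mul, a, b => a * b
  | .div, a, b => a / b
  | .mod, a, b => a % b

inductive RealOp
  | add | sub | mul | div

/-- A quotient by `0` is `0`. -/
noncomputable def RealOp.eval : RealOp → ℝ → ℝ → ℝ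
  | .add, a, b => a + b
  | .sub, a, b => a - b
  | .mul, a, b => a * b
  | .div, a, b => a / b

/-- The instructions, each of unit cost. Real constants are rational, and there is no conversion
(such as rounding) of reals into words. -/
inductive Instr
  /-- `w_i := c` -/
  | wconst (i c : ℕ)
  /-- `w_i := w_j op w_k` -/
  | wop (op : WordOp) (i j k : ℕ)
  /-- `w_i := a[w_j]` for the word array `a` -/
  | wload (i a j : ℕ)
  /-- `a[w_j] := w_i` for the word array `a` -/
  | wstore (a j i : ℕ)
  /-- `r_i := q` -/
  | rconst (i : ℕ) (q : ℚ)
  /-- `r_i := w_j` -/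
  | rword (i j : ℕ)
  /-- `r_i := r_j op r_k` -/
  | rop (op : RealOp) (i j k : ℕ)
  /-- `r_i := a[w_j]` for the real array `a` -/
  | rload (i a j : ℕ)
  /-- `a[w_j] := r_i` for the real array `a` -/
  | rstore (a j i : ℕ)

/-- The effect of an instruction on the state. -/
noncomputable def Instr.run : Instr → State → State
  | .wconst i c, s => { s with wreg := Function.update s.wreg i c }
  | .wop op i j k, s =>
      { s with wreg := Function.update s.wreg i (op.eval (s.wreg j) (s.wreg k)) }
  | .wload i a j, s => { s with wreg := Function.update s.wreg i (s.warr a (s.wreg j)) }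
  | .wstore a j i, s =>
      let row := Function.update (s.warr a) (s.wreg j) (s.wreg i)
      { s with warr := Function.update s.warr a row }
  | .rconst i q, s => { s with rreg := Function.update s.rreg i (q : ℝ) }
  | .rword i j, s => { s with rreg := Function.update s.rreg i (s.wreg j : ℝ) }
  | .rop op i j k, s =>
      { s with rreg := Function.update s.rreg i (op.eval (s.rreg j) (s.rreg k)) }
  | .rload i a j, s => { s with rreg := Function.update s.rreg i (s.rarr a (s.wreg j)) }
  | .rstore a j i, s =>
      let row := Function.update (s.rarr a) (s.wreg j) (s.rreg i)
      { s with rarr := Function.update s.rarr a row }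

/-- The instruction creates no word of more than `b` bits. -/
def Instr.Fits (b : ℕ) : Instr → State → Prop
  | .wconst _ c, _ => c < 2 ^ b
  | .wop op _ j k, s => op.eval (s.wreg j) (s.wreg k) < 2 ^ b
  | _, _ => True

/-- The tests, each of unit cost: comparisons of two words or of two reals. -/
inductive Test
  | wlt (i j : ℕ)
  | weq (i j : ℕ)
  | rlt (i j : ℕ)
  | rle (i j : ℕ)

def Test.Holds : Test → State → Prop
  | .wlt i j, s => s.wreg i < s.wreg j
  | .weq i j, s => s.wreg i = s.wreg j
  | .rlt i j, s => s.rreg i < s.rreg j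
  | .rle i j, s => s.rreg i ≤ s.rreg j

inductive Program
  | skip
  | instr (a : Instr)
  | seq (p q : Program)
  | ite (c : Test) (p q : Program)
  | loop (c : Test) (p : Program)

/-- `Exec b p s t s'`: on a machine with `b`-bit words, the program `p`, started in the state `s`,
halts in the state `s'` after `t` steps. An instruction that overflows has no outcome, so then
the program does not halt properly. -/
inductive Exec (b : ℕ) : Program → State → ℕ → State → Prop
  | skip (s : State) : Exec b .skip s 1 s
  | instr (a : Instr) (s : State) (h : a.Fits b s) : Exec b (.instr a) s 1 (a.run s)
  | seq {p q : Program} {s s' s'' : State} {t t' : ℕ} (hp : Exec b p s t s')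
      (hq : Exec b q s' t' s'') : Exec b (.seq p q) s (t + t') s''
  | iteTrue {c : Test} {p q : Program} {s s' : State} {t : ℕ} (hc : c.Holds s)
      (hp : Exec b p s t s') : Exec b (.ite c p q) s (t + 1) s'
  | iteFalse {c : Test} {p q : Program} {s s' : State} {t : ℕ} (hc : ¬ c.Holds s)
      (hq : Exec b q s t s') : Exec b (.ite c p q) s (t + 1) s'
  | loopDone {c : Test} {p : Program} {s : State} (hc : ¬ c.Holds s) :
      Exec b (.loop c p) s 1 s
  | loopStep {c : Test} {p : Program} {s s' s'' : State} {t t' : ℕ} (hc : c.Holds s)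
      (hp : Exec b p s t s') (hl : Exec b (.loop c p) s' t' s'') :
      Exec b (.loop c p) s (t + t' + 1) s''

/-- The initial state for the samples `(v_i, y_i)`, `i < n`: the number `n` is in word register
`0`, the predictions are in real array `0`, the outcomes are in word array `0`, and everything
else is zero. -/
noncomputable def initState {n : ℕ} (x : Fin n → Sample) : State where
  wreg i := if i = 0 then n else 0
  rreg _ := 0
  warr a i := if h : a = 0 ∧ i < n then (x ⟨i, h.2⟩).2.toNat else 0
  rarr a i := if h : a = 0 ∧ i < n then ((x ⟨i, h.2⟩).1 : ℝ) else 0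

/-- On a machine with `b`-bit words, the program `p` halts on the samples `x` after at most `t`
steps with the answer `ans` (`1` for "yes", `0` for "no") in word register `0`. -/
def AnswersWithin (b : ℕ) (p : Program) {n : ℕ} (x : Fin n → Sample) (t : ℕ) (ans : Bool) :
    Prop :=
  ∃ (t' : ℕ) (s : State), t' ≤ t ∧ Exec b p (initState x) t' s ∧ s.wreg 0 = ans.toNat

end RealRAM

/-!
# Calibration testing at the optimal rate in nearly linear time

The threshold `ε_n` is of order `1 / √n`, and a tester of accuracy `45 / √n` runs in time
`O(n log n)`.

*The statistic.* The integral of a Lipschitz function against the bias measure `E[y - v ; v ∈ ·]` is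
controlled, after integration by parts, by the total bias and the mean absolute value of the
cumulative bias `F(t) = E[(y - v) 1[v ≤ t]]`. The tester uses this quantity (`gridNorm` of
`cumBias`) with predictions rounded down to the grid of mesh `1 / n`. In one dimension no
optimization over Lipschitz functions is needed, so a pass over the grid computes it.

*The statistic is comparable to the distance to calibration.* If `(u, v, y)` is a calibrated
extension, then the statistic is `E[(y - v') w(v)]` for the rounded prediction `v'` and a bounded
step function `w` that is Lipschitz above the grid scale; as `E[(y - u) w(u)] = 0`, it is
`O(E|u - v| + 1 / n)` (`gridNorm_le_of_mem_calibratedExtensions`). Conversely a calibrated extension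
of cost at most twice the statistic, up to `1 / n`, is constructed (`lowerDistCal_le_gridNorm`):
positive biases are transported to negative ones along the line, at a cost given by the cumulative
biases (`exists_isCancellation`); each unit of transport is realized by exchanging outcomes one of
the first cell with outcomes zero of the second; the uncancelled biases all have the same sign and
are removed by predictions `0` or `1` that are certain to be right (`exists_grid_recalibration`).

*Concentration.* Each empirical cumulative bias has standard deviation at most `1 / √n`, so the
statistic deviates by `O(1 / √n)` on average (`measureReal_gridNorm_deviation_le`), and Markov's
inequality gives probability `2/3`.

*Few samples.* For `n < 2500` the tester only checks whether the first prediction is far from the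
first outcome; this solves the problem for `ε = 99/100`
(`solvesCalibrationTesting_oneSampleRule`), and also shows that `ε_n < 1` for all `n`.

*The lower bound.* With the constant prediction `1/2`, a test must tell a coin of bias `1/2 + ε`
from a fair one, which is impossible for `ε < 1 / (4 √n)` by the second moment of the likelihood
ratio (`le_of_solvesCalibrationTesting`).

*The program.* The cell of each sample is found by bisection, as reals cannot be rounded, and its
bias is added to an array indexed by cells; one pass over the array sums the absolute cumulative
biases (`RealRAM.answersWithin_testerProgram`).
-/

/-! ### Calibrated extensions -/

@[fun_prop]
lemma measurable_outcome : Measurable outcome := measurable_of_finite _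

lemma outcome_nonneg (y : Bool) : 0 ≤ outcome y := by cases y <;> simp [outcome]

lemma outcome_le_one (y : Bool) : outcome y ≤ 1 := by cases y <;> simp [outcome]

lemma integrable_of_forall_abs_le {α : Type*} [MeasurableSpace α] {μ : Measure α}
    [IsFiniteMeasure μ] {f : α → ℝ} (hf : Measurable f) (C : ℝ) (hC : ∀ a, |f a| ≤ C) :
    Integrable f μ :=
  Integrable.of_bound hf.aestronglyMeasurable C (ae_of_all _ hC)

lemma abs_coe_sub_coe_le_one (u v : I) : |(u : ℝ) - v| ≤ 1 := by
  have := u.2.1; have := u.2.2; have := v.2.1; have := v.2.2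
  exact abs_le.2 ⟨by linarith, by linarith⟩

lemma abs_outcome_sub_le_one (y : Bool) (u : I) : |outcome y - u| ≤ 1 := by
  have := u.2.1; have := u.2.2; have := outcome_nonneg y; have := outcome_le_one y
  exact abs_le.2 ⟨by linarith, by linarith⟩

/-- Calibration says that the residual `y - u` is orthogonal to every bounded function of `u`. -/
lemma IsCalibrated.integral_sub_mul_eq_zero {P : Measure Sample} [IsProbabilityMeasure P]
    (h : IsCalibrated P) {g : I → ℝ} (hg : Measurable g) (C : ℝ) (hC : ∀ u, |g u| ≤ C) :
    ∫ p, (outcome p.2 - p.1) * g p.1 ∂P = 0 := by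
  have hm : MeasurableSpace.comap (Prod.fst : Sample → I) inferInstance ≤
      (inferInstance : MeasurableSpace Sample) := measurable_fst.comap_le
  have hgm : StronglyMeasurable[MeasurableSpace.comap (Prod.fst : Sample → I) inferInstance]
      (fun p : Sample => g p.1) :=
    (hg.comp (comap_measurable Prod.fst)).stronglyMeasurable
  have hy : Integrable (fun p : Sample => outcome p.2) P :=
    integrable_of_forall_abs_le (by fun_prop) 1 fun p =>
      abs_le.2 ⟨by linarith [outcome_nonneg p.2], outcome_le_one _⟩
  have hC0 : 0 ≤ C := (abs_nonneg _).trans (hC 0)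
  have hyg : Integrable (fun p : Sample => g p.1 * outcome p.2) P :=
    hy.bdd_mul (c := C) (hg.comp measurable_fst).aestronglyMeasurable (ae_of_all _ fun p => hC p.1)
  have hug : Integrable (fun p : Sample => g p.1 * (p.1 : ℝ)) P :=
    integrable_of_forall_abs_le (by fun_prop) (C * 1) fun p => by
      rw [abs_mul]
      exact mul_le_mul (hC _) (abs_le.2 ⟨by linarith [p.1.2.1], p.1.2.2⟩) (abs_nonneg _) hC0
  have key : ∫ p, g p.1 * outcome p.2 ∂P = ∫ p, g p.1 * (p.1 : ℝ) ∂P := by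
    rw [← integral_condExp hm (f := fun p : Sample => g p.1 * outcome p.2)]
    refine integral_congr_ae ?_
    filter_upwards [condExp_mul_of_stronglyMeasurable_left hgm hyg hy, h] with p h1 h2
    refine h1.trans ?_
    simp only [Pi.mul_apply, h2]
  have : ∀ p : Sample, (outcome p.2 - p.1) * g p.1 = g p.1 * outcome p.2 - g p.1 * (p.1 : ℝ) :=
    fun p => by ring
  simp_rw [this]
  rw [integral_sub hyg hug, key, sub_self]

lemma calibratedExtensions.integral_sub_mul_eq_zero {D : Measure Sample}
    {Q : Measure (I × I × Bool)} (hQ : Q ∈ calibratedExtensions D) {g : I → ℝ}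
    (hg : Measurable g) (C : ℝ) (hC : ∀ u, |g u| ≤ C) :
    ∫ p, (outcome p.2.2 - p.1) * g p.1 ∂Q = 0 := by
  obtain ⟨h1, -, h3⟩ := hQ
  have hm : Measurable fun p : I × I × Bool => (p.1, p.2.2) := by fun_prop
  have := Measure.isProbabilityMeasure_map (μ := Q) hm.aemeasurable
  have h := h3.integral_sub_mul_eq_zero hg C hC
  rwa [integral_map hm.aemeasurable (by fun_prop)] at h

lemma calibratedExtensions.integral_comp_snd {D : Measure Sample}
    {Q : Measure (I × I × Bool)} (hQ : Q ∈ calibratedExtensions D) {g : Sample → ℝ}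
    (hg : Measurable g) : ∫ p, g p.2 ∂Q = ∫ p, g p ∂D := by
  rw [← hQ.2.1, integral_map (by fun_prop) (by fun_prop)]

/-- The coupling that sends a sample `p` to the prediction `g k` with probability `w k p`. -/
noncomputable def randomizedExtension {ι : Type*} [Fintype ι] (D : Measure Sample) (g : ι → I)
    (w : ι → Sample → ℝ) : Measure (I × I × Bool) :=
  ∑ k, (D.withDensity fun p => ENNReal.ofReal (w k p)).map fun p => (g k, p)

section RandomizedExtension

variable {ι : Type*} [Fintype ι] {D : Measure Sample} {g : ι → I} {w : ι → Sample → ℝ}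

lemma map_snd_randomizedExtension (hwm : ∀ k, Measurable (w k)) (hw0 : ∀ k p, 0 ≤ w k p)
    (hw1 : ∀ p, ∑ k, w k p = 1) :
    (randomizedExtension D g w).map (fun p => p.2) = D := by
  ext s hs
  rw [randomizedExtension, Measure.map_apply (by fun_prop) hs, Measure.finsetSum_apply]
  have : ∀ k, ((D.withDensity fun p => ENNReal.ofReal (w k p)).map fun p => (g k, p))
      ((fun p : I × I × Bool => p.2) ⁻¹' s) = ∫⁻ p in s, ENNReal.ofReal (w k p) ∂D := by
    intro k
    rw [Measure.map_apply (by fun_prop) (hs.preimage (by fun_prop))]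
    exact withDensity_apply _ hs
  simp_rw [this]
  rw [← lintegral_finsetSum _ fun k _ => (hwm k).ennreal_ofReal]
  simp_rw [← ENNReal.ofReal_sum_of_nonneg fun k _ => hw0 k _, hw1]
  simp

variable [IsProbabilityMeasure D]

lemma isProbabilityMeasure_randomizedExtension (hwm : ∀ k, Measurable (w k))
    (hw0 : ∀ k p, 0 ≤ w k p) (hw1 : ∀ p, ∑ k, w k p = 1) :
    IsProbabilityMeasure (randomizedExtension D g w) := by
  constructor
  have h := map_snd_randomizedExtension (D := D) (g := g) hwm hw0 hw1
  have h2 : ((randomizedExtension D g w).map (fun p => p.2)) Set.univ = 1 := by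
    rw [h]; exact measure_univ
  rwa [Measure.map_apply (by fun_prop) MeasurableSet.univ, Set.preimage_univ] at h2

lemma integral_randomizedExtension (hwm : ∀ k, Measurable (w k)) (hw0 : ∀ k p, 0 ≤ w k p)
    (hw1 : ∀ p, ∑ k, w k p = 1) {F : I × I × Bool → ℝ} (hF : Measurable F) (C : ℝ)
    (hC : ∀ p, |F p| ≤ C) :
    ∫ p, F p ∂(randomizedExtension D g w) = ∑ k, ∫ p, w k p * F (g k, p) ∂D := by
  have := isProbabilityMeasure_randomizedExtension (D := D) (g := g) hwm hw0 hw1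
  have hint : Integrable F (randomizedExtension D g w) := integrable_of_forall_abs_le hF C hC
  rw [randomizedExtension, integral_finsetSum_measure]
  · refine Finset.sum_congr rfl fun k _ => ?_
    rw [integral_map (by fun_prop) (by fun_prop),
      integral_withDensity_eq_integral_toReal_smul (hwm k).ennreal_ofReal
        (ae_of_all _ fun _ => ENNReal.ofReal_lt_top)]
    refine integral_congr_ae (ae_of_all _ fun p => ?_)
    simp [ENNReal.toReal_ofReal (hw0 k p)]
  · intro k _
    refine hint.mono_measure ?_
    rw [randomizedExtension]
    exact Finset.single_le_sum (f := fun k => (D.withDensity fun p => ENNReal.ofReal (w k p)).map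
      fun p => (g k, p)) (fun _ _ => Measure.zero_le _) (Finset.mem_univ k)

lemma randomizedExtension_mem (hwm : ∀ k, Measurable (w k)) (hw0 : ∀ k p, 0 ≤ w k p)
    (hw1 : ∀ p, ∑ k, w k p = 1) (hcal : ∀ k, ∫ p, w k p * (outcome p.2 - g k) ∂D = 0) :
    randomizedExtension D g w ∈ calibratedExtensions D := by
  have hP := isProbabilityMeasure_randomizedExtension (D := D) (g := g) hwm hw0 hw1
  refine ⟨hP, map_snd_randomizedExtension hwm hw0 hw1, ?_⟩
  have hm : Measurable fun p : I × I × Bool => (p.1, p.2.2) := by fun_prop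
  have := Measure.isProbabilityMeasure_map (μ := randomizedExtension D g w) hm.aemeasurable
  have hle : MeasurableSpace.comap (Prod.fst : Sample → I) inferInstance ≤
      (inferInstance : MeasurableSpace Sample) := measurable_fst.comap_le
  have hy : ∀ P : Measure Sample, IsProbabilityMeasure P →
      Integrable (fun p : Sample => outcome p.2) P := fun P _ =>
    integrable_of_forall_abs_le (by fun_prop) 1 fun p =>
      abs_le.2 ⟨by linarith [outcome_nonneg p.2], outcome_le_one _⟩
  have hu : ∀ P : Measure Sample, IsProbabilityMeasure P →
      Integrable (fun p : Sample => (p.1 : ℝ)) P := fun P _ =>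
    integrable_of_forall_abs_le (by fun_prop) 1 fun p =>
      abs_le.2 ⟨by linarith [p.1.2.1], p.1.2.2⟩
  refine (ae_eq_condExp_of_forall_setIntegral_eq hle (hy _ this)
    (fun s _ _ => (hu _ this).integrableOn) ?_ ?_).symm
  · rintro _ ⟨t, ht, rfl⟩ -
    rw [eq_comm, ← sub_eq_zero, ← integral_sub (hy _ this).integrableOn (hu _ this).integrableOn,
      ← integral_indicator (ht.preimage measurable_fst), integral_map hm.aemeasurable 
        (Measurable.indicator (by fun_prop) (ht.preimage measurable_fst)).aestronglyMeasurable]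
    have h1 : ∀ p : I × I × Bool, ((Prod.fst : Sample → I) ⁻¹' t).indicator
        (fun q : Sample => outcome q.2 - (q.1 : ℝ)) (p.1, p.2.2) =
        t.indicator (fun _ => (1 : ℝ)) p.1 * (outcome p.2.2 - p.1) := by
      intro p
      by_cases hp : p.1 ∈ t <;> simp [Set.indicator, hp]
    simp_rw [h1]
    have hF : Measurable fun p : I × I × Bool =>
        t.indicator (fun _ => (1 : ℝ)) p.1 * (outcome p.2.2 - p.1) :=
      ((measurable_const.indicator ht).comp measurable_fst).mul (by fun_prop)
    rw [integral_randomizedExtension hwm hw0 hw1 hF 1]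
    · refine Finset.sum_eq_zero fun k _ => ?_
      have h2 : ∀ p : Sample, w k p * (t.indicator (fun _ => (1 : ℝ)) (g k) *
          (outcome p.2 - g k)) = t.indicator (fun _ => (1 : ℝ)) (g k) *
          (w k p * (outcome p.2 - g k)) := fun p => by ring
      simp_rw [h2]
      rw [integral_const_mul, hcal, mul_zero]
    · intro p
      have := abs_outcome_sub_le_one p.2.2 p.1
      by_cases hp : p.1 ∈ t <;> simp [hp, this]
  · exact ((measurable_subtype_coe.comp (comap_measurable Prod.fst))
      ).stronglyMeasurable.aestronglyMeasurable

end RandomizedExtension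

lemma bddBelow_image_calibratedExtensions (D : Measure Sample) :
    BddBelow ((fun Q : Measure (I × I × Bool) => ∫ p, |(p.1 : ℝ) - (p.2.1 : ℝ)| ∂Q) ''
      calibratedExtensions D) :=
  ⟨0, by rintro _ ⟨Q, -, rfl⟩; exact integral_nonneg fun _ => abs_nonneg _⟩

/-- An upper bound on the distance to calibration from a finite randomized recalibration. -/
lemma lowerDistCal_le_sum_integral {ι : Type*} [Fintype ι] {D : Measure Sample}
    [IsProbabilityMeasure D] {g : ι → I} {w : ι → Sample → ℝ} (hwm : ∀ k, Measurable (w k))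
    (hw0 : ∀ k p, 0 ≤ w k p) (hw1 : ∀ p, ∑ k, w k p = 1)
    (hcal : ∀ k, ∫ p, w k p * (outcome p.2 - g k) ∂D = 0) :
    lowerDistCal D ≤ ∑ k, ∫ p, w k p * |(g k : ℝ) - p.1| ∂D := by
  refine (csInf_le (bddBelow_image_calibratedExtensions D)
    ⟨_, randomizedExtension_mem hwm hw0 hw1 hcal, rfl⟩).trans_eq ?_
  exact integral_randomizedExtension hwm hw0 hw1 (F := fun p => |(p.1 : ℝ) - p.2.1|)
    (by fun_prop) 1 fun p => by rw [abs_abs]; exact abs_coe_sub_coe_le_one _ _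

section MeanExtension

variable (D : Measure Sample) [IsProbabilityMeasure D]

lemma integrable_outcome : Integrable (fun p : Sample => outcome p.2) D :=
  integrable_of_forall_abs_le (by fun_prop) 1 fun p =>
    abs_le.2 ⟨by linarith [outcome_nonneg p.2], outcome_le_one _⟩

/-- The mean outcome, as a prediction. -/
noncomputable def meanOutcome : I :=
  ⟨∫ p, outcome p.2 ∂D, integral_nonneg fun _ => outcome_nonneg _, by
    simpa using integral_mono (integrable_outcome D) (integrable_const 1)
      fun p => outcome_le_one p.2⟩

lemma coe_meanOutcome : (meanOutcome D : ℝ) = ∫ p, outcome p.2 ∂D := rfl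

lemma integral_meanOutcome_residual :
    ∫ p : Sample, (1 : ℝ) * (outcome p.2 - meanOutcome D) ∂D = 0 := by
  simp_rw [one_mul]
  rw [integral_sub (integrable_outcome D) (integrable_const _), coe_meanOutcome]
  simp

/-- The constant prediction `E[y]` is always calibrated. -/
lemma calibratedExtensions_nonempty : (calibratedExtensions D).Nonempty :=
  ⟨_, randomizedExtension_mem (ι := Unit) (g := fun _ => meanOutcome D) (w := fun _ _ => 1)
    (fun _ => measurable_const) (fun _ _ => zero_le_one) (by simp)
    fun _ => integral_meanOutcome_residual D⟩

lemma lowerDistCal_le_integral_meanOutcome :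
    lowerDistCal D ≤ ∫ p, |(meanOutcome D : ℝ) - p.1| ∂D := by
  simpa using lowerDistCal_le_sum_integral (ι := Unit) (D := D) (g := fun _ => meanOutcome D)
    (w := fun _ _ => 1)
    (fun _ => measurable_const) (fun _ _ => zero_le_one) (by simp)
    fun _ => integral_meanOutcome_residual D

variable {D}

/-- The infimum need not be known to be attained: distance zero gives arbitrarily cheap
extensions. -/
lemma exists_extension_lt_of_lowerDistCal_eq_zero (h : lowerDistCal D = 0) {η : ℝ}
    (hη : 0 < η) :
    ∃ Q ∈ calibratedExtensions D, ∫ p, |(p.1 : ℝ) - p.2.1| ∂Q < η := by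
  have h' : sInf ((fun Q : Measure (I × I × Bool) => ∫ p, |(p.1 : ℝ) - (p.2.1 : ℝ)| ∂Q) ''
      calibratedExtensions D) < η := by
    change lowerDistCal D < η
    rwa [h]
  obtain ⟨_, ⟨Q, hQ, rfl⟩, hlt⟩ :=
    exists_lt_of_csInf_lt ((calibratedExtensions_nonempty D).image _) h'
  exact ⟨Q, hQ, hlt⟩

end MeanExtension

/-! ### Cancelling biases on a line -/

/-- `π` transports part of the positive masses among `a 0, …, a (N - 1)` onto negative ones, and
`ρ` is what remains of them. All residues have the same sign, and the work done, if the residues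
are carried on to the point `N`, is at most the sum of the absolute partial sums of `a`. -/
structure IsCancellation (a : ℕ → ℝ) (N : ℕ) (π : ℕ → ℕ → ℝ) (ρ : ℕ → ℝ) : Prop where
  nonneg : ∀ j k, 0 ≤ π j k
  support : ∀ j k, π j k ≠ 0 → j < N ∧ k < N ∧ 0 < a j ∧ a k < 0
  residue : ∀ j < N, ρ j = a j - ∑ k ∈ Finset.range N, π j k + ∑ k ∈ Finset.range N, π k j
  residue_nonneg : ∀ j < N, 0 < a j → 0 ≤ ρ j
  residue_nonpos : ∀ j < N, a j < 0 → ρ j ≤ 0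
  same_sign : (∀ j < N, 0 ≤ ρ j) ∨ (∀ j < N, ρ j ≤ 0)
  cost : ∑ j ∈ Finset.range N, ∑ k ∈ Finset.range N, π j k * |(j : ℝ) - k| +
      ∑ j ∈ Finset.range N, |ρ j| * ((N : ℝ) - j) ≤
    ∑ i ∈ Finset.range N, |∑ l ∈ Finset.range (i + 1), a l|

namespace IsCancellation

variable {a : ℕ → ℝ} {N : ℕ} {π : ℕ → ℕ → ℝ} {ρ : ℕ → ℝ}

lemma neg (h : IsCancellation a N π ρ) :
    IsCancellation (fun j => - a j) N (fun j k => π k j) (fun j => - ρ j) where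
  nonneg j k := h.nonneg k j
  support j k hjk := by
    obtain ⟨h1, h2, h3, h4⟩ := h.support k j hjk
    exact ⟨h2, h1, by linarith, by linarith⟩
  residue j hj := by rw [h.residue j hj]; ring
  residue_nonneg j hj ha := by linarith [h.residue_nonpos j hj (by linarith)]
  residue_nonpos j hj ha := by linarith [h.residue_nonneg j hj (by linarith)]
  same_sign := by
    rcases h.same_sign with h | h
    · exact Or.inr fun j hj => by linarith [h j hj]
    · exact Or.inl fun j hj => by linarith [h j hj]
  cost := by
    have h1 := h.cost
    simp only [Finset.sum_neg_distrib, abs_neg]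
    rw [Finset.sum_comm]
    simpa only [abs_sub_comm] using h1

lemma sum_residue (h : IsCancellation a N π ρ) :
    ∑ j ∈ Finset.range N, ρ j = ∑ j ∈ Finset.range N, a j := by
  rw [Finset.sum_congr rfl fun j hj => h.residue j (Finset.mem_range.1 hj),
    Finset.sum_add_distrib, Finset.sum_sub_distrib,
    Finset.sum_comm (f := fun j k => π k j)]
  ring

lemma sum_abs_residue (h : IsCancellation a N π ρ) :
    ∑ j ∈ Finset.range N, |ρ j| = |∑ j ∈ Finset.range N, a j| := by
  rw [← h.sum_residue]
  rcases h.same_sign with h | h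
  · rw [abs_of_nonneg (Finset.sum_nonneg fun j hj => h j (Finset.mem_range.1 hj))]
    exact Finset.sum_congr rfl fun j hj => abs_of_nonneg (h j (Finset.mem_range.1 hj))
  · rw [abs_of_nonpos (Finset.sum_nonpos fun j hj => h j (Finset.mem_range.1 hj)),
      ← Finset.sum_neg_distrib]
    exact Finset.sum_congr rfl fun j hj => abs_of_nonpos (h j (Finset.mem_range.1 hj))

lemma row_eq_zero (h : IsCancellation a N π ρ) {j : ℕ} (ha : a j ≤ 0) (k : ℕ) : π j k = 0 := by
  by_contra hne
  linarith [(h.support j k hne).2.2.1]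

lemma col_eq_zero (h : IsCancellation a N π ρ) {k : ℕ} (ha : 0 ≤ a k) (j : ℕ) : π j k = 0 := by
  by_contra hne
  linarith [(h.support j k hne).2.2.2]

lemma residue_eq_zero (h : IsCancellation a N π ρ) {j : ℕ} (hj : j < N) (ha : a j = 0) :
    ρ j = 0 := by
  rw [h.residue j hj, ha]
  simp [h.row_eq_zero ha.le, h.col_eq_zero ha.ge]

/-- The new point `N` absorbs the same fraction `θ` of every residue. -/
lemma step_of_residue_nonneg (h : IsCancellation a N π ρ) (hρ : ∀ j < N, 0 ≤ ρ j) :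
    ∃ π' ρ', IsCancellation a (N + 1) π' ρ' := by
  set S := ∑ j ∈ Finset.range N, ρ j with hS
  have hS0 : 0 ≤ S := Finset.sum_nonneg fun j hj => hρ j (Finset.mem_range.1 hj)
  have hSa : S = ∑ j ∈ Finset.range N, a j := h.sum_residue
  obtain ⟨θ, hθ0, hθ1, hθN, hsgn, hpos⟩ : ∃ θ : ℝ, 0 ≤ θ ∧ θ ≤ 1 ∧ (θ ≠ 0 → a N < 0) ∧
      ((θ = 1 ∧ a N + θ * S ≤ 0) ∨ 0 ≤ a N + θ * S) ∧ (a N < 0 → a N + θ * S ≤ 0) := by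
    by_cases haN : 0 ≤ a N
    · exact ⟨0, le_rfl, zero_le_one, fun h => (h rfl).elim, Or.inr (by simpa using haN),
        fun h => by linarith⟩
    · push Not at haN
      by_cases hle : - a N ≤ S
      · have hSpos : 0 < S := by linarith
        have : -a N / S * S = - a N := div_mul_cancel₀ _ hSpos.ne'
        exact ⟨-a N / S, div_nonneg (by linarith) hS0, (div_le_one hSpos).2 hle, fun _ => haN,
          Or.inr (by rw [this]; simp), fun _ => by rw [this]; simp⟩
      · exact ⟨1, zero_le_one, le_rfl, fun _ => haN, Or.inl ⟨rfl, by linarith⟩,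
          fun _ => by linarith⟩
  let π' : ℕ → ℕ → ℝ := fun j k => if k = N then (if j < N then θ * ρ j else 0) else π j k
  let ρ' : ℕ → ℝ := fun j => if j = N then a N + θ * S else (1 - θ) * ρ j
  have hπlt : ∀ j k, k < N → π' j k = π j k := fun j k hk => by simp [π', hk.ne]
  have hπN : ∀ j, j < N → π' j N = θ * ρ j := fun j hj => by simp [π', hj]
  have hπNN : π' N N = 0 := by simp [π']
  have hπrow : ∀ k, π' N k = 0 := by
    intro k
    by_cases hk : k = N
    · rw [hk, hπNN]
    · simp only [π', hk, if_false]
      by_contra hne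
      exact lt_irrefl _ (h.support _ _ hne).1
  have hρlt : ∀ j, j < N → ρ' j = (1 - θ) * ρ j := fun j hj => by simp [ρ', hj.ne]
  have hρN : ρ' N = a N + θ * S := by simp [ρ']
  have hsame : (∀ j < N + 1, 0 ≤ ρ' j) ∨ (∀ j < N + 1, ρ' j ≤ 0) := by
    rcases hsgn with ⟨h1, h2⟩ | h2
    · right
      intro j hj
      rcases Nat.lt_succ_iff_lt_or_eq.1 hj with hj | rfl
      · rw [hρlt j hj, h1]; simp
      · rwa [hρN]
    · left
      intro j hj
      rcases Nat.lt_succ_iff_lt_or_eq.1 hj with hj | rfl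
      · rw [hρlt j hj]; exact mul_nonneg (by linarith) (hρ j hj)
      · rwa [hρN]
  have hsum' : ∑ j ∈ Finset.range (N + 1), ρ' j = ∑ j ∈ Finset.range (N + 1), a j := by
    rw [Finset.sum_range_succ, Finset.sum_range_succ, hρN, ← hSa,
      Finset.sum_congr rfl fun j hj => hρlt j (Finset.mem_range.1 hj), ← Finset.mul_sum, ← hS]
    ring
  have habs' : ∑ j ∈ Finset.range (N + 1), |ρ' j| = |∑ j ∈ Finset.range (N + 1), a j| := by
    rw [← hsum']
    rcases hsame with h | h
    · rw [abs_of_nonneg (Finset.sum_nonneg fun j hj => h j (Finset.mem_range.1 hj))]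
      exact Finset.sum_congr rfl fun j hj => abs_of_nonneg (h j (Finset.mem_range.1 hj))
    · rw [abs_of_nonpos (Finset.sum_nonpos fun j hj => h j (Finset.mem_range.1 hj)),
        ← Finset.sum_neg_distrib]
      exact Finset.sum_congr rfl fun j hj => abs_of_nonpos (h j (Finset.mem_range.1 hj))
  refine ⟨π', ρ', ?_, ?_, ?_, ?_, ?_, hsame, ?_⟩
  · intro j k
    by_cases hk : k = N
    · subst hk
      by_cases hj : j < k
      · rw [hπN j hj]; exact mul_nonneg hθ0 (hρ j hj)
      · simp [π', hj]
    · simpa [π', hk] using h.nonneg j k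
  · intro j k hne
    by_cases hk : k = N
    · subst hk
      by_cases hj : j < k
      · rw [hπN j hj] at hne
        have hθne : θ ≠ 0 := left_ne_zero_of_mul hne
        have hρne : ρ j ≠ 0 := right_ne_zero_of_mul hne
        refine ⟨by omega, by omega, ?_, hθN hθne⟩
        rcases lt_trichotomy (a j) 0 with ha | ha | ha
        · exact absurd (le_antisymm (h.residue_nonpos j hj ha) (hρ j hj)) hρne
        · exact absurd (h.residue_eq_zero hj ha) hρne
        · exact ha
      · simp [π', hj] at hne
    · simp only [π', hk, if_false] at hne
      obtain ⟨h1, h2, h3⟩ := h.support j k hne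
      exact ⟨by omega, by omega, h3⟩
  · intro j hj
    rcases Nat.lt_succ_iff_lt_or_eq.1 hj with hj | rfl
    · rw [hρlt j hj, Finset.sum_range_succ, Finset.sum_range_succ, hπN j hj, hπrow j,
        Finset.sum_congr rfl fun k hk => hπlt j k (Finset.mem_range.1 hk),
        Finset.sum_congr rfl fun k _ => hπlt k j hj]
      rw [h.residue j hj]
      ring
    · rw [hρN, Finset.sum_range_succ, Finset.sum_range_succ, hπNN,
        Finset.sum_congr rfl fun k _ => hπrow k,
        Finset.sum_congr rfl fun k hk => hπN k (Finset.mem_range.1 hk), ← Finset.mul_sum, ← hS]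
      simp
  · intro j hj ha
    rcases Nat.lt_succ_iff_lt_or_eq.1 hj with hj | rfl
    · rw [hρlt j hj]; exact mul_nonneg (by linarith) (hρ j hj)
    · rw [hρN]; positivity
  · intro j hj ha
    rcases Nat.lt_succ_iff_lt_or_eq.1 hj with hj | rfl
    · rw [hρlt j hj]
      exact mul_nonpos_of_nonneg_of_nonpos (by linarith) (h.residue_nonpos j hj ha)
    · rw [hρN]; exact hpos ha
  · have e1 : ∑ j ∈ Finset.range (N + 1), ∑ k ∈ Finset.range (N + 1), π' j k * |(j : ℝ) - k| =
        ∑ j ∈ Finset.range N, ∑ k ∈ Finset.range N, π j k * |(j : ℝ) - k| +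
          ∑ j ∈ Finset.range N, θ * (|ρ j| * ((N : ℝ) - j)) := by
      rw [Finset.sum_range_succ, ← Finset.sum_add_distrib]
      simp only [hπrow, zero_mul, Finset.sum_const_zero, add_zero]
      refine Finset.sum_congr rfl fun j hj => ?_
      have hj' := Finset.mem_range.1 hj
      rw [Finset.sum_range_succ, hπN j hj', abs_of_nonneg (hρ j hj'), abs_sub_comm (j : ℝ) N,
        abs_of_nonneg (sub_nonneg.2 (Nat.cast_le.2 hj'.le) : (0 : ℝ) ≤ (N : ℝ) - j)]
      congr 1
      · exact Finset.sum_congr rfl fun k hk => by rw [hπlt j k (Finset.mem_range.1 hk)]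
      · ring
    have e2 : ∑ j ∈ Finset.range (N + 1), |ρ' j| * (((N + 1 : ℕ) : ℝ) - j) =
        ∑ j ∈ Finset.range N, (1 - θ) * (|ρ j| * ((N : ℝ) - j)) +
          |∑ j ∈ Finset.range (N + 1), a j| := by
      have : ∀ j : ℕ, |ρ' j| * (((N + 1 : ℕ) : ℝ) - j) = |ρ' j| * ((N : ℝ) - j) + |ρ' j| := by
        intro j; push_cast; ring
      simp_rw [this]
      rw [Finset.sum_add_distrib, habs', Finset.sum_range_succ]
      simp only [sub_self, mul_zero, add_zero]
      congr 1
      refine Finset.sum_congr rfl fun j hj => ?_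
      rw [hρlt j (Finset.mem_range.1 hj), abs_mul, abs_of_nonneg (by linarith : (0 : ℝ) ≤ 1 - θ)]
      ring
    rw [e1, e2, Finset.sum_range_succ (fun i => |∑ l ∈ Finset.range (i + 1), a l|),
      ← Finset.mul_sum, ← Finset.mul_sum]
    linarith [h.cost]

end IsCancellation

lemma exists_isCancellation (a : ℕ → ℝ) (N : ℕ) : ∃ π ρ, IsCancellation a N π ρ := by
  induction N with
  | zero => exact ⟨fun _ _ => 0, fun _ => 0, by constructor <;> simp⟩
  | succ N ih =>
    obtain ⟨π, ρ, h⟩ := ih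
    rcases h.same_sign with hs | hs
    · exact h.step_of_residue_nonneg hs
    · obtain ⟨π', ρ', h'⟩ := h.neg.step_of_residue_nonneg fun j hj => by linarith [hs j hj]
      exact ⟨_, _, by simpa using h'.neg⟩

/-! ### Recalibration on a grid -/

/-- Given masses `o j` of outcome one and `z j` of outcome zero at the grid points `j / m`, there is
a way to move them between the grid points after which every grid point is calibrated, at a cost
controlled by the partial sums of the biases `o j * (1 - j / m) - z j * (j / m)`. A mass `π j k`
taken from a positive bias at `j` and a negative one at `k` is corrected by exchanging outcomes one
at `j` with outcomes zero at `k`; the remaining biases have a common sign and are corrected by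
sending outcomes one to the prediction `1` or outcomes zero to the prediction `0`. -/
lemma exists_grid_recalibration {m : ℕ} (hm : 0 < m) (o z : ℕ → ℝ) (ho : ∀ j, 0 ≤ o j)
    (hz : ∀ j, 0 ≤ z j) (a : ℕ → ℝ)
    (ha : ∀ j, a j = o j * (1 - (j : ℝ) / m) - z j * ((j : ℝ) / m)) :
    ∃ A B : ℕ → ℕ → ℝ, (∀ j ≤ m, ∀ k, 0 ≤ A j k) ∧ (∀ j ≤ m, ∀ k, 0 ≤ B j k) ∧
      (∀ j ≤ m, ∑ k ∈ Finset.range (m + 1), A j k = o j) ∧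
      (∀ j ≤ m, ∑ k ∈ Finset.range (m + 1), B j k = z j) ∧
      (∀ k ≤ m, (∑ j ∈ Finset.range (m + 1), A j k) * (1 - (k : ℝ) / m) =
        (∑ j ∈ Finset.range (m + 1), B j k) * ((k : ℝ) / m)) ∧
      ∑ j ∈ Finset.range (m + 1), ∑ k ∈ Finset.range (m + 1),
        (A j k + B j k) * (|(j : ℝ) - k| / m) ≤
      2 * (1 / m * ∑ i ∈ Finset.range (m + 1), |∑ l ∈ Finset.range (i + 1), a l|) +
        |∑ l ∈ Finset.range (m + 1), a l| := by
  obtain ⟨π, ρ, h⟩ := exists_isCancellation a (m + 1)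
  have hm' : (0 : ℝ) < m := Nat.cast_pos.2 hm
  set R : ℕ → ℝ := fun j => ∑ k ∈ Finset.range (m + 1), π j k with hR
  set C : ℕ → ℝ := fun j => ∑ k ∈ Finset.range (m + 1), π k j with hC
  set d : ℕ → ℝ := fun j => max (ρ j) 0 / (1 - (j : ℝ) / m) with hd
  set e : ℕ → ℝ := fun j => max (- ρ j) 0 / ((j : ℝ) / m) with he
  have hv0 : ∀ j : ℕ, (0 : ℝ) ≤ (j : ℝ) / m := fun j => by positivity
  have hv1 : ∀ j : ℕ, j ≤ m → (0 : ℝ) ≤ 1 - (j : ℝ) / m := fun j hj => by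
    rw [sub_nonneg, div_le_one hm']; exact_mod_cast hj
  have hd0 : ∀ j ≤ m, 0 ≤ d j := fun j hj => div_nonneg (le_max_right _ _) (hv1 j hj)
  have he0 : ∀ j ≤ m, 0 ≤ e j := fun j hj => div_nonneg (le_max_right _ _) (hv0 j)
  have hres : ∀ j ≤ m, ρ j = a j - R j + C j := fun j hj => h.residue j (Nat.lt_succ_of_le hj)
  -- Where a denominator in `d` or `e` vanishes, so does the numerator: at the prediction `1` no
  -- bias is positive, and at `0` none is negative. So the convention `x / 0 = 0` is harmless.
  have hdρ : ∀ j ≤ m, d j * (1 - (j : ℝ) / m) = max (ρ j) 0 := by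
    intro j hj
    by_cases h1 : 1 - (j : ℝ) / m = 0
    · have haj : a j ≤ 0 := by
        rw [ha, h1]; nlinarith [mul_nonneg (hz j) (hv0 j)]
      have : ρ j ≤ 0 := by
        rcases haj.lt_or_eq with h2 | h2
        · exact h.residue_nonpos j (Nat.lt_succ_of_le hj) h2
        · exact (h.residue_eq_zero (Nat.lt_succ_of_le hj) h2).le
      rw [h1, max_eq_right this, mul_zero]
    · exact div_mul_cancel₀ _ h1
  have heρ : ∀ j ≤ m, e j * ((j : ℝ) / m) = max (- ρ j) 0 := by
    intro j hj
    by_cases h1 : (j : ℝ) / m = 0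
    · have haj : 0 ≤ a j := by
        rw [ha, h1]; simp [ho j]
      have : 0 ≤ ρ j := by
        rcases haj.lt_or_eq with h2 | h2
        · exact h.residue_nonneg j (Nat.lt_succ_of_le hj) h2
        · exact (h.residue_eq_zero (Nat.lt_succ_of_le hj) h2.symm).ge
      rw [h1, max_eq_right (by linarith), mul_zero]
    · exact div_mul_cancel₀ _ h1
  have hA : ∀ j ≤ m, 0 ≤ o j - R j - d j := by
    intro j hj
    rcases le_or_gt (a j) 0 with haj | haj
    · have h1 : R j = 0 := Finset.sum_eq_zero fun k _ => h.row_eq_zero haj k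
      have h2 : ρ j ≤ 0 := by
        rcases haj.lt_or_eq with h2 | h2
        · exact h.residue_nonpos j (Nat.lt_succ_of_le hj) h2
        · exact (h.residue_eq_zero (Nat.lt_succ_of_le hj) h2).le
      simp [h1, hd, max_eq_right h2, ho j]
    · have h1 : C j = 0 := Finset.sum_eq_zero fun k _ => h.col_eq_zero haj.le k
      have h2 := h.residue_nonneg j (Nat.lt_succ_of_le hj) haj
      have h3 := hres j hj
      have h4 := hdρ j hj
      rw [max_eq_left h2] at h4
      have h5 : 0 ≤ R j := Finset.sum_nonneg fun k _ => h.nonneg j k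
      have hzz := mul_nonneg (hz j) (hv0 j)
      have hpos : 0 < 1 - (j : ℝ) / m := by
        rcases (hv1 j hj).lt_or_eq with h6 | h6
        · exact h6
        · rw [ha, ← h6] at haj; linarith
      refine nonneg_of_mul_nonneg_left ?_ hpos
      have := ha j
      nlinarith [mul_nonneg h5 (hv0 j)]
  have hB : ∀ j ≤ m, 0 ≤ z j - C j - e j := by
    intro j hj
    rcases le_or_gt 0 (a j) with haj | haj
    · have h1 : C j = 0 := Finset.sum_eq_zero fun k _ => h.col_eq_zero haj k
      have h2 : 0 ≤ ρ j := by
        rcases haj.lt_or_eq with h2 | h2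
        · exact h.residue_nonneg j (Nat.lt_succ_of_le hj) h2
        · exact (h.residue_eq_zero (Nat.lt_succ_of_le hj) h2.symm).ge
      simp [h1, he, h2, hz j]
    · have h1 : R j = 0 := Finset.sum_eq_zero fun k _ => h.row_eq_zero haj.le k
      have h2 := h.residue_nonpos j (Nat.lt_succ_of_le hj) haj
      have h3 := hres j hj
      have h4 := heρ j hj
      rw [max_eq_left (by linarith)] at h4
      have h5 : 0 ≤ C j := Finset.sum_nonneg fun k _ => h.nonneg k j
      have hoo := mul_nonneg (ho j) (hv1 j hj)
      have hpos : 0 < (j : ℝ) / m := by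
        rcases (hv0 j).lt_or_eq with h6 | h6
        · exact h6
        · rw [ha, ← h6] at haj; linarith [ho j]
      refine nonneg_of_mul_nonneg_left ?_ hpos
      have := ha j
      nlinarith [mul_nonneg h5 (hv1 j hj)]
  have hsumite : ∀ (k : ℕ) (f : ℕ → ℝ), k ≤ m →
      (∑ j ∈ Finset.range (m + 1), if k = j then f j else 0) = f k := fun k f hk => by
    rw [Finset.sum_ite_eq, if_pos (Finset.mem_range.2 (Nat.lt_succ_of_le hk))]
  have hsumite' : ∀ (k : ℕ) (f : ℕ → ℝ), k ≤ m →
      (∑ j ∈ Finset.range (m + 1), if j = k then f j else 0) = f k := fun k f hk => by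
    rw [Finset.sum_ite_eq', if_pos (Finset.mem_range.2 (Nat.lt_succ_of_le hk))]
  refine ⟨fun j k => π j k + (if k = m then d j else 0) + (if k = j then o j - R j - d j else 0),
    fun j k => π k j + (if k = 0 then e j else 0) + (if k = j then z j - C j - e j else 0),
    ?_, ?_, ?_, ?_, ?_, ?_⟩
  · intro j hj k
    have := h.nonneg j k; have := hd0 j hj; have := hA j hj
    dsimp only
    split_ifs <;> linarith
  · intro j hj k
    have := h.nonneg k j; have := he0 j hj; have := hB j hj
    dsimp only
    split_ifs <;> linarith
  · intro j hj
    simp only [Finset.sum_add_distrib]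
    rw [hsumite' m (fun _ => d j) le_rfl, hsumite' j (fun _ => o j - R j - d j) hj]
    simp only [hR]; ring
  · intro j hj
    simp only [Finset.sum_add_distrib]
    rw [hsumite' 0 (fun _ => e j) (Nat.zero_le _), hsumite' j (fun _ => z j - C j - e j) hj]
    simp only [hC]; ring
  · intro k hk
    simp only [Finset.sum_add_distrib]
    rw [hsumite k (fun j => o j - R j - d j) hk, hsumite k (fun j => z j - C j - e j) hk]
    have t1 : (∑ j ∈ Finset.range (m + 1), if k = m then d j else 0) * (1 - (k : ℝ) / m) = 0 := by
      by_cases hkm : k = m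
      · rw [hkm, div_self hm'.ne', sub_self, mul_zero]
      · simp [hkm]
    have t2 : (∑ j ∈ Finset.range (m + 1), if k = 0 then e j else 0) * ((k : ℝ) / m) = 0 := by
      by_cases hk0 : k = 0
      · simp [hk0]
      · simp [hk0]
    have h1 := hdρ k hk
    have h2 := heρ k hk
    have h3 := hres k hk
    have h4 : max (ρ k) 0 - max (- ρ k) 0 = ρ k := by
      rcases le_total 0 (ρ k) with h | h
      · rw [max_eq_left h, max_eq_right (by linarith)]; ring
      · rw [max_eq_right h, max_eq_left (by linarith)]; ring
    change (C k + _ + _) * _ = (R k + _ + _) * _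
    linear_combination t1 - t2 - h1 + h2 - h4 - h3 - ha k
  · have hcost := h.cost
    have habs := h.sum_abs_residue
    have hle : ∑ j ∈ Finset.range (m + 1), ∑ k ∈ Finset.range (m + 1), π j k * |(j : ℝ) - k| ≤
        ∑ i ∈ Finset.range (m + 1), |∑ l ∈ Finset.range (i + 1), a l| := by
      refine le_trans (le_add_of_nonneg_right (Finset.sum_nonneg fun j hj => ?_)) hcost
      refine mul_nonneg (abs_nonneg _) (sub_nonneg.2 ?_)
      exact_mod_cast (Finset.mem_range.1 hj).le
    have hrow : ∀ j ≤ m, ∑ k ∈ Finset.range (m + 1),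
        ((π j k + (if k = m then d j else 0) + (if k = j then o j - R j - d j else 0)) +
        (π k j + (if k = 0 then e j else 0) + (if k = j then z j - C j - e j else 0))) *
          (|(j : ℝ) - k| / m) =
        ∑ k ∈ Finset.range (m + 1), (π j k * |(j : ℝ) - k|) / m +
        ∑ k ∈ Finset.range (m + 1), (π k j * |(k : ℝ) - j|) / m + |ρ j| := by
      intro j hj
      have hterm : ∀ k : ℕ,
          ((π j k + (if k = m then d j else 0) + (if k = j then o j - R j - d j else 0)) +
          (π k j + (if k = 0 then e j else 0) + (if k = j then z j - C j - e j else 0))) *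
            (|(j : ℝ) - k| / m) =
          (π j k * |(j : ℝ) - k|) / m + (π k j * |(k : ℝ) - j|) / m +
          (if k = m then d j * (|(j : ℝ) - k| / m) else 0) +
          (if k = 0 then e j * (|(j : ℝ) - k| / m) else 0) := by
        intro k
        rw [abs_sub_comm (k : ℝ) j]
        by_cases hkj : k = j
        · subst hkj; simp
        · simp only [hkj, if_false]
          split_ifs <;> ring
      simp only [hterm, Finset.sum_add_distrib]
      rw [hsumite' m (fun k => d j * (|(j : ℝ) - k| / m)) le_rfl,
        hsumite' 0 (fun k => e j * (|(j : ℝ) - k| / m)) (Nat.zero_le _)]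
      have h1 : |(j : ℝ) - m| / m = 1 - (j : ℝ) / m := by
        rw [abs_sub_comm, abs_of_nonneg (sub_nonneg.2 (Nat.cast_le.2 hj)), sub_div,
          div_self hm'.ne']
      have h2 : |(j : ℝ) - (0 : ℕ)| / m = (j : ℝ) / m := by simp
      rw [h1, h2, hdρ j hj, heρ j hj, add_assoc]
      congr 1
      rcases le_total 0 (ρ j) with h | h
      · rw [max_eq_left h, max_eq_right (by linarith), abs_of_nonneg h, add_zero]
      · rw [max_eq_right h, max_eq_left (by linarith), abs_of_nonpos h, zero_add]
    rw [Finset.sum_congr rfl fun j hj => hrow j (Nat.le_of_lt_succ (Finset.mem_range.1 hj))]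
    rw [Finset.sum_add_distrib, Finset.sum_add_distrib, habs,
      Finset.sum_comm (f := fun j k => π k j * |(k : ℝ) - j| / m), ← two_mul]
    simp_rw [← Finset.sum_div]
    have := div_le_div_of_nonneg_right hle hm'.le
    rw [one_div, inv_mul_eq_div]
    linarith

/-! ### The grid statistic -/

/-- The cell `⌊v m⌋` of a prediction in the grid of mesh `1 / m`. The prediction `1` is alone in
the cell `m`. -/
noncomputable def gridCell (m : ℕ) (v : I) : ℕ := ⌊(v : ℝ) * m⌋₊

lemma gridCell_le (m : ℕ) (v : I) : gridCell m v ≤ m := by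
  refine Nat.floor_le_of_le ?_
  exact mul_le_of_le_one_left (Nat.cast_nonneg _) v.2.2

@[fun_prop]
lemma measurable_gridCell (m : ℕ) : Measurable (gridCell m) := by
  unfold gridCell; fun_prop

lemma gridCell_div_le {m : ℕ} (hm : 0 < m) (v : I) : (gridCell m v : ℝ) / m ≤ v := by
  rw [div_le_iff₀ (Nat.cast_pos.2 hm)]
  exact Nat.floor_le (mul_nonneg v.2.1 (Nat.cast_nonneg _))

lemma abs_gridCell_div_sub_le {m : ℕ} (hm : 0 < m) (v : I) :
    |(gridCell m v : ℝ) / m - v| ≤ 1 / m := by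
  have hm' : (0 : ℝ) < m := Nat.cast_pos.2 hm
  have h1 := gridCell_div_le hm v
  have h2 : (v : ℝ) * m < gridCell m v + 1 := Nat.lt_floor_add_one _
  rw [abs_of_nonpos (by linarith), neg_sub, sub_le_iff_le_add, ← add_div, le_div_iff₀ hm']
  linarith

/-- The grid point `k / m`, cut off at `1`. -/
noncomputable def gridPoint (m k : ℕ) : I := Set.projIcc 0 1 zero_le_one ((k : ℝ) / m)

lemma coe_gridPoint {m k : ℕ} (hm : 0 < m) (hk : k ≤ m) : (gridPoint m k : ℝ) = (k : ℝ) / m := by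
  rw [gridPoint, Set.projIcc_of_mem zero_le_one
    ⟨by positivity, by rw [div_le_one (Nat.cast_pos.2 hm)]; exact_mod_cast hk⟩]

/-- The contribution of a sample to the cumulative bias at `j / m`, with predictions rounded down
to the grid. -/
noncomputable def cellBias (m j : ℕ) (p : Sample) : ℝ :=
  if gridCell m p.1 ≤ j then outcome p.2 - (gridCell m p.1 : ℝ) / m else 0

@[fun_prop]
lemma measurable_cellBias (m j : ℕ) : Measurable (cellBias m j) := by
  unfold cellBias
  refine Measurable.ite (measurableSet_le (by fun_prop) measurable_const) ?_ measurable_const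
  fun_prop

lemma abs_outcome_sub_gridCell_le_one {m : ℕ} (hm : 0 < m) (p : Sample) :
    |outcome p.2 - (gridCell m p.1 : ℝ) / m| ≤ 1 := by
  rw [← coe_gridPoint hm (gridCell_le m p.1)]
  exact abs_outcome_sub_le_one _ _

lemma abs_cellBias_le_one {m : ℕ} (hm : 0 < m) (j : ℕ) (p : Sample) : |cellBias m j p| ≤ 1 := by
  unfold cellBias
  split_ifs
  · exact abs_outcome_sub_gridCell_le_one hm p
  · simp

/-- The size of a function on the grid: its final value and its mean. Applied to the cumulative bias
it is comparable to the dual Lipschitz norm of the bias measure. -/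
noncomputable def gridNorm (m : ℕ) (c : ℕ → ℝ) : ℝ :=
  |c m| + 1 / m * ∑ j ∈ Finset.range (m + 1), |c j|

/-- The cumulative bias of a distribution at `j / m`. -/
noncomputable def cumBias (D : Measure Sample) (m j : ℕ) : ℝ := ∫ p, cellBias m j p ∂D

section Soundness

/-- The mass of the outcome `y` in the cell `j`. -/
noncomputable def cellMass (D : Measure Sample) (m j : ℕ) (y : Bool) : ℝ :=
  D.real {p | gridCell m p.1 = j ∧ p.2 = y}

variable {D : Measure Sample} [IsProbabilityMeasure D] {m : ℕ}

lemma measurableSet_cell (m j : ℕ) (y : Bool) :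
    MeasurableSet {p : Sample | gridCell m p.1 = j ∧ p.2 = y} :=
  (measurableSet_eq_fun (by fun_prop) measurable_const).inter
    (measurableSet_eq_fun measurable_snd measurable_const)

lemma integral_cell_function (F : ℕ → Bool → ℝ) :
    ∫ p : Sample, F (gridCell m p.1) p.2 ∂D = ∑ j ∈ Finset.range (m + 1),
      (cellMass D m j true * F j true + cellMass D m j false * F j false) := by
  have hpt : ∀ p : Sample, F (gridCell m p.1) p.2 = ∑ j ∈ Finset.range (m + 1), ∑ y : Bool,
      {q : Sample | gridCell m q.1 = j ∧ q.2 = y}.indicator (fun _ => F j y) p := by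
    intro p
    rw [Finset.sum_eq_single_of_mem (gridCell m p.1)
      (Finset.mem_range.2 (Nat.lt_succ_of_le (gridCell_le m p.1)))
      fun j _ hj => Finset.sum_eq_zero fun y _ => Set.indicator_of_notMem (fun h => hj h.1.symm) _,
      Finset.sum_eq_single_of_mem p.2 (Finset.mem_univ _)
      fun y _ hy => Set.indicator_of_notMem (fun h => hy h.2.symm) _]
    simp
  have hint : ∀ j y, Integrable ({q : Sample | gridCell m q.1 = j ∧ q.2 = y}.indicator
      (fun _ => F j y)) D := fun j y =>
    (integrable_const _).indicator (measurableSet_cell m j y)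
  simp_rw [hpt]
  rw [integral_finsetSum _ fun j _ => integrable_finsetSum _ fun y _ => hint j y]
  refine Finset.sum_congr rfl fun j _ => ?_
  rw [integral_finsetSum _ fun y _ => hint j y, Fintype.sum_bool]
  simp_rw [integral_indicator_const _ (measurableSet_cell m j _), smul_eq_mul]
  rfl

lemma cumBias_eq_sum {j : ℕ} (hj : j ≤ m) :
    cumBias D m j = ∑ l ∈ Finset.range (j + 1),
      (cellMass D m l true * (1 - (l : ℝ) / m) - cellMass D m l false * ((l : ℝ) / m)) := by
  have := integral_cell_function (D := D) (m := m)
    (fun i y => if i ≤ j then outcome y - (i : ℝ) / m else 0)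
  change cumBias D m j = _ at this
  rw [this, ← Finset.sum_subset (Finset.range_subset_range.2 (Nat.succ_le_succ hj))]
  · refine Finset.sum_congr rfl fun l hl => ?_
    have hl' : l ≤ j := Nat.le_of_lt_succ (Finset.mem_range.1 hl)
    simp [hl', outcome]
    ring
  · intro l _ hl
    have hl' : ¬ l ≤ j := fun h => hl (Finset.mem_range.2 (Nat.lt_succ_of_le h))
    simp [hl']

/-- A distribution with small cumulative biases is close to calibrated. -/
theorem lowerDistCal_le_gridNorm (hm : 0 < m) :
    lowerDistCal D ≤ 2 * gridNorm m (cumBias D m) + 1 / m := by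
  have hm' : (0 : ℝ) < m := Nat.cast_pos.2 hm
  have hM0 : ∀ j y, 0 ≤ cellMass D m j y := fun j y => measureReal_nonneg
  obtain ⟨A, B, hA0, hB0, hA1, hB1, hcal, hcost⟩ := exists_grid_recalibration hm
    (fun j => cellMass D m j true) (fun j => cellMass D m j false) (fun j => hM0 j true)
    (fun j => hM0 j false) _ fun j => rfl
  -- The mass moved from cell `j` to grid point `k`, and below, as `K`, its share of the cell.
  let W : Bool → ℕ → ℕ → ℝ := fun y => if y then A else B
  have hW0 : ∀ y, ∀ j ≤ m, ∀ k, 0 ≤ W y j k := by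
    intro y j hj k
    cases y
    · exact hB0 j hj k
    · exact hA0 j hj k
  have hW1 : ∀ y, ∀ j ≤ m, ∑ k ∈ Finset.range (m + 1), W y j k = cellMass D m j y := by
    intro y j hj
    cases y
    · exact hB1 j hj
    · exact hA1 j hj
  -- A sample in a cell of mass zero stays where it is.
  let K : ℕ → Bool → ℕ → ℝ := fun j y k =>
    if cellMass D m j y = 0 then (if k = j then 1 else 0) else W y j k / cellMass D m j y
  have hK0 : ∀ j ≤ m, ∀ y k, 0 ≤ K j y k := by
    intro j hj y k
    simp only [K]
    split_ifs
    · exact zero_le_one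
    · exact le_rfl
    · exact div_nonneg (hW0 y j hj k) (hM0 j y)
  have hK1 : ∀ j ≤ m, ∀ y, ∑ k ∈ Finset.range (m + 1), K j y k = 1 := by
    intro j hj y
    by_cases h0 : cellMass D m j y = 0
    · simp only [K, h0, if_true]
      rw [Finset.sum_ite_eq', if_pos (Finset.mem_range.2 (Nat.lt_succ_of_le hj))]
    · simp only [K, h0, if_false]
      rw [← Finset.sum_div, hW1 y j hj, div_self h0]
  have hKW : ∀ j ≤ m, ∀ y, ∀ k ≤ m, cellMass D m j y * K j y k = W y j k := by
    intro j hj y k hk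
    by_cases h0 : cellMass D m j y = 0
    · have := (Finset.sum_eq_zero_iff_of_nonneg fun k _ => hW0 y j hj k).1
        ((hW1 y j hj).trans h0) k (Finset.mem_range.2 (Nat.lt_succ_of_le hk))
      rw [h0, this, zero_mul]
    · simp only [K, h0, if_false]
      exact mul_div_cancel₀ _ h0
  have hle : ∀ k : Fin (m + 1), (k : ℕ) ≤ m := fun k => Nat.le_of_lt_succ k.2
  have hwm : ∀ k : Fin (m + 1), Measurable fun p : Sample => K (gridCell m p.1) p.2 k := fun k => by
    have h1 : Measurable fun q : ℕ × Bool => K q.1 q.2 k := measurable_of_countable _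
    exact h1.comp (f := fun p : Sample => (gridCell m p.1, p.2)) (by fun_prop)
  have hw0 : ∀ (k : Fin (m + 1)) (p : Sample), 0 ≤ K (gridCell m p.1) p.2 k := fun k p =>
    hK0 _ (gridCell_le m p.1) _ _
  have hw1 : ∀ p : Sample, ∑ k : Fin (m + 1), K (gridCell m p.1) p.2 k = 1 := fun p => by
    rw [Fin.sum_univ_eq_sum_range (fun k => K (gridCell m p.1) p.2 k)]
    exact hK1 _ (gridCell_le m p.1) _
  have hKle : ∀ (k : Fin (m + 1)) (p : Sample), K (gridCell m p.1) p.2 k ≤ 1 := fun k p => by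
    rw [← hw1 p]
    exact Finset.single_le_sum (f := fun k : Fin (m + 1) => K (gridCell m p.1) p.2 k)
      (fun k _ => hw0 k p) (Finset.mem_univ k)
  have hmain := lowerDistCal_le_sum_integral (D := D)
    (g := fun k : Fin (m + 1) => gridPoint m k)
    (w := fun k p => K (gridCell m p.1) p.2 k) hwm hw0 hw1 ?_
  · refine hmain.trans ?_
    have hbd : ∀ k : Fin (m + 1), ∫ p : Sample, K (gridCell m p.1) p.2 k *
        |(gridPoint m k : ℝ) - p.1| ∂D ≤
        ∫ p : Sample, K (gridCell m p.1) p.2 k * (|(gridCell m p.1 : ℝ) - (k : ℕ)| / m) ∂D +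
        ∫ p : Sample, K (gridCell m p.1) p.2 k * (1 / m) ∂D := by
      intro k
      have hi : Integrable (fun p : Sample => K (gridCell m p.1) p.2 k *
          (|(gridCell m p.1 : ℝ) - (k : ℕ)| / m)) D := by
        refine integrable_of_forall_abs_le ((hwm k).mul (by fun_prop)) (1 * 1) fun p => ?_
        rw [abs_mul, abs_of_nonneg (hw0 k p)]
        refine mul_le_mul (hKle k p) ?_ (abs_nonneg _) zero_le_one
        have h1 : (gridCell m p.1 : ℝ) ≤ m := by exact_mod_cast gridCell_le m p.1
        have h2 : ((k : ℕ) : ℝ) ≤ m := by exact_mod_cast hle k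
        have h3 : (0 : ℝ) ≤ gridCell m p.1 := Nat.cast_nonneg _
        have h4 : (0 : ℝ) ≤ (k : ℕ) := Nat.cast_nonneg _
        rw [abs_of_nonneg (by positivity), div_le_one hm']
        exact abs_le.2 ⟨by linarith, by linarith⟩
      have hi2 : Integrable (fun p : Sample => K (gridCell m p.1) p.2 k * (1 / (m : ℝ))) D := by
        refine Integrable.mul_const ?_ _
        exact integrable_of_forall_abs_le (hwm k) 1 fun p => by
          rw [abs_of_nonneg (hw0 k p)]; exact hKle k p
      have hi3 : Integrable (fun p : Sample => K (gridCell m p.1) p.2 k *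
          |(gridPoint m k : ℝ) - p.1|) D := by
        refine integrable_of_forall_abs_le ((hwm k).mul (by fun_prop)) (1 * 1) fun p => ?_
        rw [abs_mul, abs_of_nonneg (hw0 k p), abs_abs]
        exact mul_le_mul (hKle k p) (abs_coe_sub_coe_le_one _ _) (abs_nonneg _) zero_le_one
      rw [← integral_add hi hi2]
      refine integral_mono hi3 (hi.add hi2) fun p => ?_
      simp only
      rw [← mul_add, coe_gridPoint hm (hle k)]
      refine mul_le_mul_of_nonneg_left ?_ (hw0 k p)
      have h1 := abs_gridCell_div_sub_le hm p.1
      have h2 : |(gridCell m p.1 : ℝ) - (k : ℕ)| / m =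
          |((k : ℕ) : ℝ) / m - (gridCell m p.1 : ℝ) / m| := by
        rw [← sub_div, abs_div, abs_of_pos hm', abs_sub_comm]
      rw [h2]
      exact (abs_sub_le _ ((gridCell m p.1 : ℝ) / m) _).trans (by linarith)
    refine (Finset.sum_le_sum fun k _ => hbd k).trans ?_
    rw [Finset.sum_add_distrib]
    have e2 : ∑ k : Fin (m + 1), ∫ p : Sample, K (gridCell m p.1) p.2 k * (1 / m) ∂D = 1 / m := by
      rw [← integral_finsetSum]
      · simp_rw [← Finset.sum_mul, hw1]
        simp
      · intro k _
        refine Integrable.mul_const ?_ _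
        exact integrable_of_forall_abs_le (hwm k) 1 fun p => by
          rw [abs_of_nonneg (hw0 k p)]; exact hKle k p
    have e1 : ∑ k : Fin (m + 1), ∫ p : Sample, K (gridCell m p.1) p.2 k *
        (|(gridCell m p.1 : ℝ) - (k : ℕ)| / m) ∂D =
        ∑ j ∈ Finset.range (m + 1), ∑ k ∈ Finset.range (m + 1),
          (A j k + B j k) * (|(j : ℝ) - k| / m) := by
      rw [Finset.sum_comm, ← Fin.sum_univ_eq_sum_range (fun k => ∑ j ∈ Finset.range (m + 1),
        (A j k + B j k) * (|(j : ℝ) - k| / m))]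
      refine Finset.sum_congr rfl fun k _ => ?_
      rw [integral_cell_function (fun j y => K j y k * (|(j : ℝ) - (k : ℕ)| / m))]
      refine Finset.sum_congr rfl fun j hj => ?_
      have hj' := Nat.le_of_lt_succ (Finset.mem_range.1 hj)
      have h1 := hKW j hj' true k (hle k)
      have h2 := hKW j hj' false k (hle k)
      simp only [W, if_true, Bool.false_eq_true, if_false] at h1 h2
      rw [← h1, ← h2]
      ring
    rw [e1, e2]
    have e3 : ∑ i ∈ Finset.range (m + 1), |∑ l ∈ Finset.range (i + 1),
        (cellMass D m l true * (1 - (l : ℝ) / m) - cellMass D m l false * ((l : ℝ) / m))| =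
        ∑ i ∈ Finset.range (m + 1), |cumBias D m i| :=
      Finset.sum_congr rfl fun i hi => by
        rw [cumBias_eq_sum (Nat.le_of_lt_succ (Finset.mem_range.1 hi))]
    rw [e3, ← cumBias_eq_sum le_rfl] at hcost
    have := abs_nonneg (cumBias D m m)
    unfold gridNorm
    linarith
  · intro k
    refine (integral_cell_function (D := D) (m := m)
      fun j y => K j y k * (outcome y - gridPoint m k)).trans ?_
    rw [coe_gridPoint hm (hle k)]
    have h2 := hcal k (hle k)
    have h3 : ∀ j ∈ Finset.range (m + 1),
        cellMass D m j true * (K j true k * (outcome true - ((k : ℕ) : ℝ) / m)) +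
        cellMass D m j false * (K j false k * (outcome false - ((k : ℕ) : ℝ) / m)) =
        A j k * (1 - ((k : ℕ) : ℝ) / m) - B j k * (((k : ℕ) : ℝ) / m) := by
      intro j hj
      have hj' := Nat.le_of_lt_succ (Finset.mem_range.1 hj)
      have h1 := hKW j hj' true k (hle k)
      have h2 := hKW j hj' false k (hle k)
      simp only [W, if_true, Bool.false_eq_true, if_false] at h1 h2
      rw [← h1, ← h2]
      simp only [outcome, if_true, Bool.false_eq_true, if_false]
      ring
    rw [Finset.sum_congr rfl h3, Finset.sum_sub_distrib, ← Finset.sum_mul, ← Finset.sum_mul, h2,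
      sub_self]

end Soundness

section Completeness

/-- For coefficients `t j` in `[-1, 1]`, the function `c ↦ ∑ t j 1[c ≤ j]` of a cell is
`1`-Lipschitz. -/
lemma abs_sum_ite_sub_sum_ite_le {m : ℕ} (t : ℕ → ℝ) (ht : ∀ j, |t j| ≤ 1) (c d : ℕ) :
    |(∑ j ∈ Finset.range (m + 1), if c ≤ j then t j else 0) -
      ∑ j ∈ Finset.range (m + 1), if d ≤ j then t j else 0| ≤ |(c : ℝ) - d| := by
  wlog hcd : c ≤ d generalizing c d
  · rw [abs_sub_comm, abs_sub_comm (c : ℝ)]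
    exact this d c (le_of_not_ge hcd)
  rw [← Finset.sum_sub_distrib]
  have h1 : ∀ j ∈ Finset.range (m + 1), |(if c ≤ j then t j else 0) - (if d ≤ j then t j else 0)| ≤
      if j ∈ Finset.Ico c d then 1 else 0 := by
    intro j _
    have := ht j
    by_cases h1 : c ≤ j <;> by_cases h2 : d ≤ j
    · simp [h1, h2, not_lt.2 h2]
    · simpa [h1, h2, not_le.1 h2] using this
    · omega
    · simp [h1, h2]
  refine (Finset.abs_sum_le_sum_abs _ _).trans ((Finset.sum_le_sum h1).trans ?_)
  rw [Finset.sum_ite_mem, Finset.sum_const, nsmul_eq_mul, mul_one, abs_sub_comm,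
    abs_of_nonneg (sub_nonneg.2 (Nat.cast_le.2 hcd)), ← Nat.cast_sub hcd]
  exact_mod_cast (Finset.card_le_card Finset.inter_subset_right).trans_eq (Nat.card_Ico c d)

lemma abs_gridCell_sub_gridCell_le (m : ℕ) (u v : I) :
    |(gridCell m u : ℝ) - gridCell m v| ≤ |(u : ℝ) - v| * m + 1 := by
  have h1 : (u : ℝ) * m < gridCell m u + 1 := Nat.lt_floor_add_one _
  have h2 : (gridCell m u : ℝ) ≤ u * m := Nat.floor_le (mul_nonneg u.2.1 (Nat.cast_nonneg _))
  have h3 : (v : ℝ) * m < gridCell m v + 1 := Nat.lt_floor_add_one _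
  have h4 : (gridCell m v : ℝ) ≤ v * m := Nat.floor_le (mul_nonneg v.2.1 (Nat.cast_nonneg _))
  have hm : (0 : ℝ) ≤ m := Nat.cast_nonneg _
  have h5 := mul_le_mul_of_nonneg_right (le_abs_self ((u : ℝ) - v)) hm
  have h6 := mul_le_mul_of_nonneg_right (neg_abs_le ((u : ℝ) - v)) hm
  exact abs_le.2 ⟨by linarith, by linarith⟩

variable {D : Measure Sample} [IsProbabilityMeasure D] {m : ℕ}

/-- Cumulative biases bound the distance of any calibrated extension from below. Their grid norm is
`E[(y - v') w(v)]` for the rounded prediction `v'` and a step function `w` that is Lipschitz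
above the grid scale, and `E[(y - u) w(u)] = 0`. -/
theorem gridNorm_le_of_mem_calibratedExtensions (hm : 0 < m) {Q : Measure (I × I × Bool)}
    (hQ : Q ∈ calibratedExtensions D) :
    gridNorm m (cumBias D m) ≤ 4 * (∫ p, |(p.1 : ℝ) - (p.2.1 : ℝ)| ∂Q + 1 / m) := by
  have hm' : (0 : ℝ) < m := Nat.cast_pos.2 hm
  have := hQ.1
  have hsg : ∀ x : ℝ, |(SignType.sign x : ℝ)| ≤ 1 := by
    intro x
    rcases lt_trichotomy x 0 with h | h | h <;> simp [h]
  set s : ℝ := (SignType.sign (cumBias D m m) : ℝ) with hs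
  set t : ℕ → ℝ := fun j => (SignType.sign (cumBias D m j) : ℝ) with ht
  let w : I → ℝ := fun v =>
    s + 1 / m * ∑ j ∈ Finset.range (m + 1), if gridCell m v ≤ j then t j else 0
  have hwm : Measurable w := by
    refine measurable_const.add (measurable_const.mul (Finset.measurable_sum _ fun j _ => ?_))
    exact Measurable.ite (measurableSet_le (by fun_prop) measurable_const) measurable_const
      measurable_const
  have hwL : ∀ u v, |w v - w u| ≤ |(u : ℝ) - v| + 1 / m := by
    intro u v
    have h1 := abs_sum_ite_sub_sum_ite_le (m := m) t (fun j => hsg _) (gridCell m v) (gridCell m u)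
    have h2 := abs_gridCell_sub_gridCell_le m v u
    have h3 : w v - w u = 1 / m *
        ((∑ j ∈ Finset.range (m + 1), if gridCell m v ≤ j then t j else 0) -
        ∑ j ∈ Finset.range (m + 1), if gridCell m u ≤ j then t j else 0) := by
      simp only [w]; ring
    rw [h3, abs_mul, abs_of_pos (by positivity : (0 : ℝ) < 1 / m), one_div, inv_mul_le_iff₀ hm',
      mul_add, mul_inv_cancel₀ hm'.ne', abs_sub_comm (u : ℝ)]
    linarith
  have hwB : ∀ v, |w v| ≤ 3 := by
    intro v
    have h1 : |∑ j ∈ Finset.range (m + 1), if gridCell m v ≤ j then t j else 0| ≤ m + 1 := by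
      refine (Finset.abs_sum_le_sum_abs _ _).trans
        ((Finset.sum_le_sum (g := fun _ => (1 : ℝ)) fun j _ => ?_).trans ?_)
      · split_ifs
        · exact hsg _
        · simp
      · simp
    refine (abs_add_le _ _).trans ?_
    rw [abs_mul, abs_of_pos (by positivity : (0 : ℝ) < 1 / m)]
    have h2 : 1 / (m : ℝ) *
        |∑ j ∈ Finset.range (m + 1), if gridCell m v ≤ j then t j else 0| ≤ 2 := by
      rw [one_div, inv_mul_le_iff₀ hm']
      have : (1 : ℝ) ≤ m := by exact_mod_cast hm
      linarith
    linarith [hsg (cumBias D m m)]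
  have hcint : ∀ j, Integrable (cellBias m j) D := fun j =>
    integrable_of_forall_abs_le (by fun_prop) 1 (abs_cellBias_le_one hm j)
  -- The signs `s` and `t` turn the grid norm into a linear functional of the bias.
  have hlin : gridNorm m (cumBias D m) =
      ∫ p : Sample, (outcome p.2 - (gridCell m p.1 : ℝ) / m) * w p.1 ∂D := by
    have h1 : ∀ p : Sample, (outcome p.2 - (gridCell m p.1 : ℝ) / m) * w p.1 =
        s * cellBias m m p + 1 / m * ∑ j ∈ Finset.range (m + 1), t j * cellBias m j p := by
      intro p
      simp only [w, cellBias, gridCell_le, if_true]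
      rw [mul_add, mul_left_comm, Finset.mul_sum]
      congr 1
      · ring
      · congr 1
        refine Finset.sum_congr rfl fun j _ => ?_
        split_ifs <;> ring
    simp_rw [h1]
    rw [integral_add ((hcint m).const_mul s) ((integrable_finsetSum _ fun j _ =>
      (hcint j).const_mul _).const_mul _), integral_const_mul, integral_const_mul,
      integral_finsetSum _ fun j _ => (hcint j).const_mul _]
    simp_rw [integral_const_mul]
    simp only [gridNorm, hs, ht, ← cumBias.eq_def]
    simp_rw [sign_mul_self]
  rw [hlin, ← calibratedExtensions.integral_comp_snd hQ
    (g := fun p : Sample => (outcome p.2 - (gridCell m p.1 : ℝ) / m) * w p.1) (by fun_prop)]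
  have horth := calibratedExtensions.integral_sub_mul_eq_zero hQ hwm 3 hwB
  have hi1 : Integrable (fun p : I × I × Bool => (outcome p.2.2 - p.1) * w p.1) Q :=
    integrable_of_forall_abs_le (by fun_prop) (1 * 3) fun p => by
      rw [abs_mul]
      exact mul_le_mul (abs_outcome_sub_le_one _ _) (hwB _) (abs_nonneg _) zero_le_one
  have hi2 : Integrable (fun p : I × I × Bool =>
      (outcome p.2.2 - (gridCell m p.2.1 : ℝ) / m) * w p.2.1) Q :=
    integrable_of_forall_abs_le (by fun_prop) (1 * 3) fun p => by
      rw [abs_mul]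
      exact mul_le_mul (abs_outcome_sub_gridCell_le_one hm p.2) (hwB _) (abs_nonneg _) zero_le_one
  have hi3 : Integrable (fun p : I × I × Bool => |(p.1 : ℝ) - (p.2.1 : ℝ)|) Q :=
    integrable_of_forall_abs_le (by fun_prop) 1 fun p => by
      rw [abs_abs]; exact abs_coe_sub_coe_le_one _ _
  rw [← sub_zero (∫ p, _ ∂Q), ← horth, ← integral_sub hi2 hi1]
  have hfin : ∫ p : I × I × Bool, 4 * (|(p.1 : ℝ) - (p.2.1 : ℝ)| + 1 / m) ∂Q =
      4 * (∫ p, |(p.1 : ℝ) - (p.2.1 : ℝ)| ∂Q + 1 / m) := by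
    rw [integral_const_mul, integral_add hi3 (integrable_const _)]
    simp
  rw [← hfin]
  refine integral_mono (hi2.sub hi1) ((hi3.add (integrable_const _)).const_mul 4) fun p => ?_
  have h1 := abs_gridCell_div_sub_le hm p.2.1
  have h2 := hwL p.1 p.2.1
  have h3 := hwB p.2.1
  have h4 := abs_outcome_sub_le_one p.2.2 p.1
  have h5 : (outcome p.2.2 - (gridCell m p.2.1 : ℝ) / m) * w p.2.1 -
      (outcome p.2.2 - p.1) * w p.1 = (outcome p.2.2 - p.1) * (w p.2.1 - w p.1) +
      (p.1 - (gridCell m p.2.1 : ℝ) / m) * w p.2.1 := by ring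
  change (outcome p.2.2 - (gridCell m p.2.1 : ℝ) / m) * w p.2.1 -
      (outcome p.2.2 - p.1) * w p.1 ≤ _
  have h6 : |(p.1 : ℝ) - (gridCell m p.2.1 : ℝ) / m| ≤ |(p.1 : ℝ) - p.2.1| + 1 / m := by
    rw [abs_sub_comm] at h1
    exact (abs_sub_le _ (p.2.1 : ℝ) _).trans (by linarith)
  have h7 := mul_le_mul h4 h2 (abs_nonneg _) zero_le_one
  have h8 := mul_le_mul h6 h3 (abs_nonneg _) ((abs_nonneg _).trans h6)
  rw [← abs_mul] at h7 h8
  rw [h5]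
  linarith [le_abs_self ((outcome p.2.2 - p.1) * (w p.2.1 - w p.1)),
    le_abs_self ((p.1 - (gridCell m p.2.1 : ℝ) / m) * w p.2.1)]

theorem gridNorm_le_of_lowerDistCal_eq_zero (hm : 0 < m) (h : lowerDistCal D = 0) :
    gridNorm m (cumBias D m) ≤ 4 / m := by
  refine le_of_forall_pos_le_add fun η hη => ?_
  obtain ⟨Q, hQ, hlt⟩ := exists_extension_lt_of_lowerDistCal_eq_zero h
    (by positivity : 0 < η / 4)
  have := gridNorm_le_of_mem_calibratedExtensions hm hQ
  have h4 : (4 : ℝ) / m = 4 * (1 / m) := by ring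
  linarith

end Completeness

/-! ### One sample -/

section OneSample

variable {D : Measure Sample} [IsProbabilityMeasure D]

lemma integrable_sq_outcome_sub : Integrable (fun p : Sample => (outcome p.2 - (p.1 : ℝ)) ^ 2) D :=
  integrable_of_forall_abs_le (by fun_prop) 1 fun p => by
    rw [abs_pow]
    exact pow_le_one₀ (abs_nonneg _) (abs_outcome_sub_le_one _ _)

/-- For a calibrated prediction `u`, `E[(y - u)²] = E[u (1 - u)] ≤ 1/4`. -/
lemma integral_sq_outcome_sub_le (h : lowerDistCal D = 0) :
    ∫ p : Sample, (outcome p.2 - (p.1 : ℝ)) ^ 2 ∂D ≤ 1 / 4 := by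
  refine le_of_forall_pos_le_add fun η hη => ?_
  obtain ⟨Q, hQ, hlt⟩ := exists_extension_lt_of_lowerDistCal_eq_zero h
    (by positivity : 0 < η / 2)
  have := hQ.1
  rw [← calibratedExtensions.integral_comp_snd hQ
    (g := fun p : Sample => (outcome p.2 - (p.1 : ℝ)) ^ 2) (by fun_prop)]
  -- As `y² = y`, `(y - u)² = u (1 - u) + (y - u) (1 - 2 u)`, and the last term has mean zero.
  have horth := calibratedExtensions.integral_sub_mul_eq_zero hQ
    (g := fun u : I => 1 - 2 * (u : ℝ)) (by fun_prop) 1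
    (fun u => abs_le.2 ⟨by linarith [u.2.2], by linarith [u.2.1]⟩)
  have hi1 : Integrable (fun p : I × I × Bool => (outcome p.2.2 - p.1) * (1 - 2 * (p.1 : ℝ))) Q :=
    integrable_of_forall_abs_le (by fun_prop) (1 * 1) fun p => by
      rw [abs_mul]
      exact mul_le_mul (abs_outcome_sub_le_one _ _)
        (abs_le.2 ⟨by linarith [p.1.2.2], by linarith [p.1.2.1]⟩) (abs_nonneg _) zero_le_one
  have hi3 : Integrable (fun p : I × I × Bool => |(p.1 : ℝ) - (p.2.1 : ℝ)|) Q :=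
    integrable_of_forall_abs_le (by fun_prop) 1 fun p => by
      rw [abs_abs]; exact abs_coe_sub_coe_le_one _ _
  have hi2 : Integrable (fun p : I × I × Bool => (outcome p.2.2 - (p.2.1 : ℝ)) ^ 2) Q :=
    integrable_of_forall_abs_le (by fun_prop) 1 fun p => by
      rw [abs_pow]
      exact pow_le_one₀ (abs_nonneg _) (abs_outcome_sub_le_one _ _)
  have hi4 : Integrable (fun p : I × I × Bool => 1 / 4 + 2 * |(p.1 : ℝ) - (p.2.1 : ℝ)|) Q :=
    (integrable_const _).add (hi3.const_mul 2)
  have hle : ∫ p : I × I × Bool, (outcome p.2.2 - (p.2.1 : ℝ)) ^ 2 ∂Q ≤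
      ∫ p : I × I × Bool, ((outcome p.2.2 - p.1) * (1 - 2 * (p.1 : ℝ)) +
        (1 / 4 + 2 * |(p.1 : ℝ) - (p.2.1 : ℝ)|)) ∂Q := by
    refine integral_mono hi2 (hi1.add hi4) fun p => ?_
    have hy : outcome p.2.2 ^ 2 = outcome p.2.2 := by cases p.2.2 <;> simp [outcome]
    have h1 : |(outcome p.2.2 - p.2.1) + (outcome p.2.2 - p.1)| ≤ 2 :=
      (abs_add_le _ _).trans (by
        linarith [abs_outcome_sub_le_one p.2.2 p.2.1, abs_outcome_sub_le_one p.2.2 p.1])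
    have h2 := mul_le_mul_of_nonneg_left h1 (abs_nonneg ((p.1 : ℝ) - p.2.1))
    rw [← abs_mul] at h2
    have h3 := le_abs_self (((p.1 : ℝ) - p.2.1) *
      ((outcome p.2.2 - p.2.1) + (outcome p.2.2 - p.1)))
    dsimp only
    nlinarith [sq_nonneg ((p.1 : ℝ) - 1 / 2)]
  rw [integral_add hi1 hi4, horth,
    integral_add (integrable_const _) (hi3.const_mul 2), integral_const_mul] at hle
  simp only [integral_const, probReal_univ, smul_eq_mul, one_mul] at hle
  linarith

/-- A calibrated prediction is rarely far from the outcome. -/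
lemma measureReal_sq_ge_le (h : lowerDistCal D = 0) :
    D.real {p : Sample | 81 / 100 ≤ (outcome p.2 - (p.1 : ℝ)) ^ 2} ≤ 1 / 3 := by
  have h1 := mul_meas_ge_le_integral_of_nonneg (μ := D)
    (ae_of_all _ fun p : Sample => sq_nonneg (outcome p.2 - (p.1 : ℝ)))
    integrable_sq_outcome_sub (81 / 100)
  have h2 := integral_sq_outcome_sub_le h
  linarith

/-- A prediction at almost maximal distance from calibration is mostly far from the outcome. With
`p = E[y]`, `E|p - v|` is at most `max(p, 1 - p)` and at most `E|y - v| + 2p(1 - p)`. -/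
lemma measureReal_sq_lt_le (h : 99 / 100 ≤ lowerDistCal D) :
    D.real {p : Sample | (outcome p.2 - (p.1 : ℝ)) ^ 2 < 81 / 100} ≤ 1 / 3 := by
  set c : I := meanOutcome D with hc
  have hle := h.trans (lowerDistCal_le_integral_meanOutcome D)
  rw [← hc] at hle
  have hc0 := c.2.1
  have hc1 := c.2.2
  have hi1 : Integrable (fun p : Sample => |(c : ℝ) - p.1|) D :=
    integrable_of_forall_abs_le (by fun_prop) 1 fun p => by
      rw [abs_abs]; exact abs_coe_sub_coe_le_one _ _
  have hmax : 99 / 100 ≤ max (c : ℝ) (1 - c) := by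
    refine hle.trans ((integral_mono hi1 (integrable_const (max (c : ℝ) (1 - c)))
      fun p => ?_).trans_eq (by simp))
    have := p.1.2.1; have := p.1.2.2
    rcases abs_cases ((c : ℝ) - p.1) with ⟨h1, -⟩ | ⟨h1, -⟩
    · exact le_max_of_le_left (by linarith)
    · exact le_max_of_le_right (by linarith)
  have hvar : (c : ℝ) * (1 - c) ≤ 1 / 100 := by
    rcases le_max_iff.1 hmax with h1 | h1 <;> nlinarith
  set E : Set Sample := {p : Sample | (outcome p.2 - (p.1 : ℝ)) ^ 2 < 81 / 100} with hE
  have hEm : MeasurableSet E := measurableSet_lt (by fun_prop) measurable_const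
  have hiE : Integrable (E.indicator fun _ => (1 : ℝ)) D := (integrable_const _).indicator hEm
  have hiy := integrable_outcome D
  have hcy : ∫ p, outcome p.2 ∂D = c := rfl
  have hpt : ∀ p : Sample, |(c : ℝ) - p.1| ≤
      (1 - 1 / 10 * E.indicator (fun _ => (1 : ℝ)) p) + (c + (1 - 2 * c) * outcome p.2) := by
    intro p
    have h1 : |(c : ℝ) - outcome p.2| ≤ c + (1 - 2 * c) * outcome p.2 := by
      rw [abs_le]
      cases p.2 <;> simp only [outcome] <;> constructor <;> norm_num <;> linarith
    have h2 : |outcome p.2 - p.1| ≤ 1 - 1 / 10 * E.indicator (fun _ => (1 : ℝ)) p := by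
      by_cases hp : p ∈ E
      · rw [Set.indicator_of_mem hp]
        have h3 : |outcome p.2 - (p.1 : ℝ)| ^ 2 < (9 / 10) ^ 2 := by
          rw [sq_abs]; norm_num; exact hp
        linarith [lt_of_pow_lt_pow_left₀ 2 (by norm_num) h3]
      · rw [Set.indicator_of_notMem hp]
        simpa using abs_outcome_sub_le_one p.2 p.1
    exact (abs_sub_le _ (outcome p.2) _).trans (by linarith)
  have hi2 : Integrable (fun p : Sample => 1 - 1 / 10 * E.indicator (fun _ => (1 : ℝ)) p) D :=
    (integrable_const _).sub (hiE.const_mul _)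
  have hi3 : Integrable (fun p : Sample => (c : ℝ) + (1 - 2 * c) * outcome p.2) D :=
    (integrable_const _).add (hiy.const_mul _)
  have hint := integral_mono hi1 (hi2.add hi3) hpt
  have heval : ∫ p : Sample, ((1 - 1 / 10 * E.indicator (fun _ => (1 : ℝ)) p) +
      (c + (1 - 2 * c) * outcome p.2)) ∂D =
      1 - 1 / 10 * D.real E + (c + (1 - 2 * c) * c) := by
    rw [integral_add hi2 hi3, integral_sub (integrable_const (1 : ℝ)) (hiE.const_mul _),
      integral_add (integrable_const (c : ℝ)) (hiy.const_mul _),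
      integral_const_mul, integral_const_mul, hcy, integral_indicator_const _ hEm]
    simp
  have hint' : ∫ p : Sample, |(c : ℝ) - p.1| ∂D ≤
      1 - 1 / 10 * D.real E + (c + (1 - 2 * c) * c) := hint.trans_eq heval
  nlinarith

end OneSample

/-! ### Concentration of the empirical statistic -/

/-- The cumulative bias of the empirical distribution of the samples `x`. -/
noncomputable def empCumBias {n : ℕ} (x : Fin n → Sample) (m j : ℕ) : ℝ :=
  1 / n * ∑ i, cellBias m j (x i)

@[fun_prop]
lemma measurable_empCumBias {n : ℕ} (m j : ℕ) :
    Measurable fun x : Fin n → Sample => empCumBias x m j := by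
  unfold empCumBias; fun_prop

lemma measurable_gridNorm_empCumBias {n : ℕ} (m : ℕ) :
    Measurable fun x : Fin n → Sample => gridNorm m (empCumBias x m) := by
  unfold gridNorm; fun_prop

lemma abs_gridNorm_sub_gridNorm_le (m : ℕ) (c d : ℕ → ℝ) :
    |gridNorm m c - gridNorm m d| ≤ gridNorm m fun j => c j - d j := by
  have h : gridNorm m c - gridNorm m d =
      (|c m| - |d m|) + 1 / m * ∑ j ∈ Finset.range (m + 1), (|c j| - |d j|) := by
    simp only [gridNorm, Finset.sum_sub_distrib]; ring
  rw [h]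
  refine (abs_add_le _ _).trans (add_le_add (abs_abs_sub_abs_le_abs_sub _ _) ?_)
  rw [abs_mul, abs_of_nonneg (by positivity : (0 : ℝ) ≤ 1 / m)]
  refine mul_le_mul_of_nonneg_left ?_ (by positivity)
  exact (Finset.abs_sum_le_sum_abs _ _).trans
    (Finset.sum_le_sum fun j _ => abs_abs_sub_abs_le_abs_sub _ _)

section Concentration

variable {D : Measure Sample} [IsProbabilityMeasure D] {n : ℕ}

/-- An empirical mean of a function bounded by one deviates by at most `1 / √n` on average. -/
lemma integral_abs_mean_sub_le (hn : 0 < n) {f : Sample → ℝ} (hf : Measurable f)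
    (hf1 : ∀ p, |f p| ≤ 1) :
    ∫ x : Fin n → Sample, |1 / n * ∑ i, f (x i) - ∫ p, f p ∂D| ∂(Measure.pi fun _ => D) ≤
      1 / √n := by
  have hn' : (0 : ℝ) < n := Nat.cast_pos.2 hn
  have hs : 0 < √(n : ℝ) := Real.sqrt_pos.2 hn'
  have hss : √(n : ℝ) * √n = n := Real.mul_self_sqrt hn'.le
  set μ := ∫ p, f p ∂D with hμ
  set P : Measure (Fin n → Sample) := Measure.pi fun _ => D
  have hmem : MemLp f 2 D := MemLp.of_bound hf.aestronglyMeasurable 1 (ae_of_all _ hf1)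
  have hsumm : Measurable fun x : Fin n → Sample => ∑ i, f (x i) := by fun_prop
  have hsumb : ∀ x : Fin n → Sample, |∑ i, f (x i)| ≤ n := fun x =>
    (Finset.abs_sum_le_sum_abs _ _).trans
      ((Finset.sum_le_sum fun i _ => hf1 (x i)).trans_eq (by simp))
  have hμ1 : |μ| ≤ 1 := by
    refine (abs_integral_le_integral_abs).trans ((integral_mono ?_ (integrable_const 1)
      fun p => hf1 p).trans_eq (by simp))
    exact (integrable_of_forall_abs_le hf 1 hf1).abs
  have hmean : ∫ x : Fin n → Sample, ∑ i, f (x i) ∂P = n * μ := by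
    rw [integral_finsetSum _ fun i _ => integrable_comp_eval (μ := fun _ : Fin n => D)
      (integrable_of_forall_abs_le hf 1 hf1)]
    have : ∀ i : Fin n, ∫ x : Fin n → Sample, f (x i) ∂P = μ := fun i =>
      integral_comp_eval (μ := fun _ : Fin n => D) hf.aestronglyMeasurable
    rw [Finset.sum_congr rfl fun i _ => this i]
    simp
  have hvar : ∫ x : Fin n → Sample, (∑ i, f (x i) - n * μ) ^ 2 ∂P ≤ n := by
    have h1 := variance_sum_pi (μ := fun _ : Fin n => D) (X := fun _ => f) fun _ => hmem
    have h2 : Var[f; D] ≤ 1 := by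
      refine (variance_le_expectation_sq hf.aestronglyMeasurable).trans ?_
      refine (integral_mono ?_ (integrable_const 1) fun p => ?_).trans_eq (by simp)
      · exact hmem.integrable_sq
      · simpa using pow_le_one₀ (n := 2) (abs_nonneg _) (hf1 p)
    have h3 : (∑ i : Fin n, fun x : Fin n → Sample => f (x i)) = fun x => ∑ i, f (x i) := by
      ext x; simp
    rw [h3, variance_eq_integral hsumm.aemeasurable, hmean] at h1
    rw [h1]
    simpa using mul_le_of_le_one_right hn'.le h2
  have hb : ∀ x : Fin n → Sample, |∑ i, f (x i) - n * μ| ≤ 2 * n := fun x => by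
    refine (abs_sub _ _).trans ?_
    rw [abs_mul, abs_of_pos hn']
    linarith [hsumb x, mul_le_of_le_one_right hn'.le hμ1]
  have hsq : Integrable (fun x : Fin n → Sample => (∑ i, f (x i) - n * μ) ^ 2) P :=
    integrable_of_forall_abs_le (by fun_prop) ((2 * n) ^ 2) fun x => by
      rw [abs_pow]; exact pow_le_pow_left₀ (abs_nonneg _) (hb x) 2
  -- `|Y| ≤ (Y² / √n + √n) / 2` for the centred sum `Y`, whose variance is at most `n`.
  have hpt : ∀ x : Fin n → Sample, |1 / n * ∑ i, f (x i) - μ| ≤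
      (1 / (2 * n * √n)) * (∑ i, f (x i) - n * μ) ^ 2 + 1 / (2 * √n) := by
    intro x
    set Y := ∑ i, f (x i) - n * μ with hY
    have h1 : 1 / n * ∑ i, f (x i) - μ = 1 / n * Y := by rw [hY]; field_simp
    rw [h1, abs_mul, abs_of_pos (by positivity : (0 : ℝ) < 1 / n)]
    have h2 : (1 / (2 * n * √n)) * Y ^ 2 + 1 / (2 * √n) - 1 / n * |Y| =
        1 / (2 * n * √n) * (|Y| - √n) ^ 2 := by
      rw [← sq_abs Y]
      field_simp
      nlinarith
    have h3 : 0 ≤ 1 / (2 * n * √n) * (|Y| - √n) ^ 2 := by positivity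
    linarith
  have hint : Integrable (fun x : Fin n → Sample => |1 / n * ∑ i, f (x i) - μ|) P := by
    refine integrable_of_forall_abs_le (by fun_prop) 2 fun x => ?_
    have h1 : 1 / n * ∑ i, f (x i) - μ = 1 / n * (∑ i, f (x i) - n * μ) := by field_simp
    rw [abs_abs, h1, abs_mul, abs_of_pos (by positivity : (0 : ℝ) < 1 / n), one_div,
      inv_mul_le_iff₀ hn']
    linarith [hb x]
  refine (integral_mono hint ((hsq.const_mul _).add (integrable_const _)) hpt).trans ?_
  rw [integral_add' (hsq.const_mul _) (integrable_const _), integral_const_mul]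
  simp only [integral_const, probReal_univ, smul_eq_mul, one_mul]
  have h1 := mul_le_mul_of_nonneg_left hvar (by positivity : (0 : ℝ) ≤ 1 / (2 * n * √n))
  have h2 : 1 / (2 * n * √n) * n + 1 / (2 * √n) = 1 / √(n : ℝ) := by
    field_simp; norm_num
  linarith

/-- With probability at least `2/3` the empirical statistic is within `9 / √n` of its population
value. -/
lemma measureReal_gridNorm_deviation_le (hn : 0 < n) {m : ℕ} (hm : 0 < m) :
    (Measure.pi fun _ : Fin n => D).real
      {x | 9 / √n ≤ |gridNorm m (empCumBias x m) - gridNorm m (cumBias D m)|} ≤ 1 / 3 := by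
  have hn' : (0 : ℝ) < n := Nat.cast_pos.2 hn
  have hm' : (1 : ℝ) ≤ m := by exact_mod_cast hm
  have hs : 0 < √(n : ℝ) := Real.sqrt_pos.2 hn'
  set P : Measure (Fin n → Sample) := Measure.pi fun _ => D
  have hdev : ∀ j, Integrable (fun x : Fin n → Sample => |empCumBias x m j - cumBias D m j|) P := by
    intro j
    refine integrable_of_forall_abs_le (by fun_prop) (1 + |cumBias D m j|) fun x => ?_
    rw [abs_abs]
    refine (abs_sub _ _).trans (add_le_add ?_ le_rfl)
    rw [empCumBias, abs_mul, abs_of_pos (by positivity : (0 : ℝ) < 1 / n), one_div,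
      inv_mul_le_iff₀ hn', mul_one]
    exact (Finset.abs_sum_le_sum_abs _ _).trans
      ((Finset.sum_le_sum fun i _ => abs_cellBias_le_one hm j (x i)).trans_eq (by simp))
  have hdev1 : ∀ j, ∫ x, |empCumBias x m j - cumBias D m j| ∂P ≤ 1 / √n := fun j =>
    integral_abs_mean_sub_le hn (measurable_cellBias m j) (abs_cellBias_le_one hm j)
  have hgi : Integrable (fun x : Fin n → Sample =>
      gridNorm m fun j => empCumBias x m j - cumBias D m j) P :=
    (hdev m).add ((integrable_finsetSum _ fun j _ => hdev j).const_mul _)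
  have hg : ∫ x, (gridNorm m fun j => empCumBias x m j - cumBias D m j) ∂P ≤ 3 / √n := by
    simp only [gridNorm]
    rw [integral_add (hdev m) ((integrable_finsetSum _ fun j _ => hdev j).const_mul _),
      integral_const_mul, integral_finsetSum _ fun j _ => hdev j]
    have h1 : ∑ j ∈ Finset.range (m + 1), ∫ x, |empCumBias x m j - cumBias D m j| ∂P ≤
        (m + 1) * (1 / √n) := (Finset.sum_le_sum fun j _ => hdev1 j).trans_eq (by simp)
    have h2 : 1 / (m : ℝ) * ∑ j ∈ Finset.range (m + 1),
        ∫ x, |empCumBias x m j - cumBias D m j| ∂P ≤ 2 * (1 / √n) := by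
      rw [one_div (m : ℝ), inv_mul_le_iff₀ (by linarith)]
      refine h1.trans ?_
      have : 0 < 1 / √(n : ℝ) := by positivity
      nlinarith
    have h3 : (3 : ℝ) / √n = 1 / √n + 2 * (1 / √n) := by ring
    linarith [hdev1 m]
  have hmarkov := mul_meas_ge_le_integral_of_nonneg (μ := P)
    (ae_of_all _ fun x : Fin n → Sample => (abs_nonneg _).trans (abs_gridNorm_sub_gridNorm_le m
      (empCumBias x m) (cumBias D m))) hgi (9 / √n)
  have hsub : P.real {x | 9 / √n ≤ |gridNorm m (empCumBias x m) - gridNorm m (cumBias D m)|} ≤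
      P.real {x | 9 / √n ≤ gridNorm m fun j => empCumBias x m j - cumBias D m j} :=
    measureReal_mono fun x hx => le_trans hx (abs_gridNorm_sub_gridNorm_le m _ _)
  refine hsub.trans ?_
  have h9 : (9 : ℝ) / √n = 3 * (3 / √n) := by ring
  have h3 : 0 < 3 / √(n : ℝ) := by positivity
  rw [h9] at hmarkov ⊢
  have := hmarkov.trans hg
  nlinarith

end Concentration

/-! ### The two decision rules -/

lemma solvesCalibrationTesting_deterministic {n : ℕ} {ε : ℝ} {f : (Fin n → Sample) → Bool}
    (hf : Measurable f)
    (hfar : ∀ (D : Measure Sample) [IsProbabilityMeasure D], ε ≤ lowerDistCal D →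
      (Measure.pi fun _ : Fin n => D).real {x | f x = true} ≤ 1 / 3)
    (hcal : ∀ (D : Measure Sample) [IsProbabilityMeasure D], lowerDistCal D = 0 →
      (Measure.pi fun _ : Fin n => D).real {x | f x = false} ≤ 1 / 3) :
    SolvesCalibrationTesting n ε (Kernel.deterministic f hf) := by
  intro D hD
  have key : ∀ b, (Measure.pi fun _ : Fin n => D).real {x | f x = !b} ≤ 1 / 3 →
      (2 / 3 : ℝ≥0∞) ≤
        ((Measure.pi fun _ : Fin n => D).bind (Kernel.deterministic f hf)) {b} := by
    intro b hb
    rw [Measure.deterministic_comp_eq_map, Measure.map_apply hf (measurableSet_singleton b)]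
    have hc : f ⁻¹' {b} = {x | f x = !b}ᶜ := by
      ext x; cases h : f x <;> cases b <;> simp [h]
    have h1 := probReal_compl_eq_one_sub (μ := Measure.pi fun _ : Fin n => D)
      (hf (measurableSet_singleton (!b)))
    have h2 : f ⁻¹' {!b} = {x | f x = !b} := rfl
    rw [h2, ← hc] at h1
    have h3 : (2 / 3 : ℝ) ≤ (Measure.pi fun _ : Fin n => D).real (f ⁻¹' {b}) := by linarith
    have h4 := ENNReal.ofReal_le_ofReal h3
    rw [ofReal_measureReal] at h4
    refine le_trans (le_of_eq ?_) h4
    rw [ENNReal.ofReal_div_of_pos (by norm_num)]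
    norm_num
  exact ⟨fun h => key false (hfar D h), fun h => key true (hcal D h)⟩

open Classical in
/-- Accept if the first prediction is not too far from the first outcome. -/
noncomputable def oneSampleRule {n : ℕ} (hn : 0 < n) (x : Fin n → Sample) : Bool :=
  decide ((outcome (x ⟨0, hn⟩).2 - ((x ⟨0, hn⟩).1 : ℝ)) ^ 2 < 81 / 100)

lemma measurable_oneSampleRule {n : ℕ} (hn : 0 < n) : Measurable (oneSampleRule hn) := by
  refine measurable_to_bool ?_
  have : oneSampleRule hn ⁻¹' {true} =
      {x | (outcome (x ⟨0, hn⟩).2 - ((x ⟨0, hn⟩).1 : ℝ)) ^ 2 < 81 / 100} := by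
    ext x; simp [oneSampleRule]
  rw [this]
  exact measurableSet_lt (by fun_prop) measurable_const

theorem solvesCalibrationTesting_oneSampleRule {n : ℕ} (hn : 0 < n) :
    SolvesCalibrationTesting n (99 / 100)
      (Kernel.deterministic (oneSampleRule hn) (measurable_oneSampleRule hn)) := by
  have key : ∀ (D : Measure Sample) [IsProbabilityMeasure D] (s : Set Sample), MeasurableSet s →
      (Measure.pi fun _ : Fin n => D).real {x | x ⟨0, hn⟩ ∈ s} = D.real s := by
    intro D _ s hs
    exact (measurePreserving_eval (fun _ : Fin n => D) ⟨0, hn⟩).measureReal_preimage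
      hs.nullMeasurableSet
  refine solvesCalibrationTesting_deterministic _ (fun D _ h => ?_) (fun D _ h => ?_)
  · refine le_trans (le_of_eq ?_) (measureReal_sq_lt_le h)
    rw [← key D _ (measurableSet_lt (by fun_prop) measurable_const)]
    congr 1
    ext x; simp [oneSampleRule]
  · refine le_trans (le_of_eq ?_) (measureReal_sq_ge_le h)
    rw [← key D _ (measurableSet_le measurable_const (by fun_prop))]
    congr 1
    ext x; simp [oneSampleRule]

open Classical in
/-- Accept if the empirical grid statistic, at mesh `1 / n`, is of the order of its fluctuations:
the population statistic is at most `4 / n` at distance zero, and the deviation is at most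
`9 / √n` with probability `2/3`. -/
noncomputable def gridRule {n : ℕ} (x : Fin n → Sample) : Bool :=
  decide (gridNorm n (empCumBias x n) ≤ 13 / √n)

lemma measurable_gridRule (n : ℕ) : Measurable (gridRule (n := n)) := by
  refine measurable_to_bool ?_
  have : gridRule (n := n) ⁻¹' {true} = {x | gridNorm n (empCumBias x n) ≤ 13 / √n} := by
    ext x; simp [gridRule]
  rw [this]
  exact measurableSet_le (measurable_gridNorm_empCumBias n) measurable_const

/-- The constant is `45 = 2 * (13 + 9) + 1`: a statistic of at most `(13 + 9) / √n` forces the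
distance to calibration to be at most `2 * (13 + 9) / √n + 1 / n`. -/
theorem solvesCalibrationTesting_gridRule {n : ℕ} (hn : 0 < n) :
    SolvesCalibrationTesting n (45 / √n)
      (Kernel.deterministic gridRule (measurable_gridRule n)) := by
  have hn1 : (1 : ℝ) ≤ n := by exact_mod_cast hn
  have hs : 1 ≤ √(n : ℝ) := Real.one_le_sqrt.2 hn1
  have hinv : 1 / (n : ℝ) ≤ 1 / √n := by
    refine one_div_le_one_div_of_le (by linarith) ?_
    nlinarith [Real.mul_self_sqrt (by linarith : (0 : ℝ) ≤ n)]
  have hk : ∀ a : ℝ, a / √(n : ℝ) = a * (1 / √n) := fun a => by ring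
  refine solvesCalibrationTesting_deterministic _ (fun D _ h => ?_) (fun D _ h => ?_)
  · refine (measureReal_mono fun x hx => ?_).trans
      (measureReal_gridNorm_deviation_le (D := D) hn hn)
    have h1 := lowerDistCal_le_gridNorm (D := D) hn
    have h2 : gridNorm n (empCumBias x n) ≤ 13 / √n := by simpa [gridRule] using hx
    change 9 / √n ≤ |gridNorm n (empCumBias x n) - gridNorm n (cumBias D n)|
    rw [abs_sub_comm]
    refine le_trans ?_ (le_abs_self _)
    rw [hk] at h h2 ⊢
    linarith
  · refine (measureReal_mono fun x hx => ?_).trans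
      (measureReal_gridNorm_deviation_le (D := D) hn hn)
    have h1 := gridNorm_le_of_lowerDistCal_eq_zero (D := D) hn h
    have h2 : 13 / √n < gridNorm n (empCumBias x n) := by simpa [gridRule] using hx
    change 9 / √n ≤ |gridNorm n (empCumBias x n) - gridNorm n (cumBias D n)|
    refine le_trans ?_ (le_abs_self _)
    have h3 : (4 : ℝ) / n = 4 * (1 / n) := by ring
    rw [hk] at h2 ⊢
    linarith

/-! ### The lower bound on the threshold -/

/-- The prediction `1/2`. -/
noncomputable def halfPrediction : I := ⟨1 / 2, by norm_num, by norm_num⟩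

/-- A coin with bias `q`. -/
noncomputable def coin (q : ℝ) : Measure Bool :=
  ENNReal.ofReal q • Measure.dirac true + ENNReal.ofReal (1 - q) • Measure.dirac false

/-- The prediction is always `1/2`, and the outcome is a coin with bias `q`. -/
noncomputable def coinSample (q : ℝ) : Measure Sample :=
  (coin q).map fun y => (halfPrediction, y)

section Coin

variable {q : ℝ} (hq0 : 0 ≤ q) (hq1 : q ≤ 1)

include hq0 hq1

lemma isProbabilityMeasure_coin : IsProbabilityMeasure (coin q) := by
  constructor
  simp only [coin, Measure.add_apply, Measure.smul_apply, measure_univ, smul_eq_mul, mul_one]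
  rw [← ENNReal.ofReal_add hq0 (by linarith)]
  simp

lemma isProbabilityMeasure_coinSample : IsProbabilityMeasure (coinSample q) := by
  have := isProbabilityMeasure_coin hq0 hq1
  exact Measure.isProbabilityMeasure_map (by fun_prop)

lemma coin_singleton_toReal (b : Bool) : (coin q {b}).toReal = if b then q else 1 - q := by
  have : (0 : ℝ) ≤ 1 - q := by linarith
  cases b <;> simp [coin, hq0, this]

lemma integral_coinSample {F : Sample → ℝ} (hF : Measurable F) :
    ∫ p, F p ∂(coinSample q) = q * F (halfPrediction, true) +
      (1 - q) * F (halfPrediction, false) := by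
  have := isProbabilityMeasure_coin hq0 hq1
  rw [coinSample, integral_map (by fun_prop) hF.aestronglyMeasurable,
    integral_fintype Integrable.of_finite, Fintype.sum_bool]
  simp [Measure.real, coin_singleton_toReal hq0 hq1]

/-- Every calibrated prediction has mean `E[y] = q`, so it is at least `|q - 1/2|` away from the
constant `1/2`, and the constant `q` attains this. -/
lemma lowerDistCal_coinSample : lowerDistCal (coinSample q) = |q - 1 / 2| := by
  have hP := isProbabilityMeasure_coinSample hq0 hq1
  have hy : ∫ p, outcome p.2 ∂(coinSample q) = q := by
    rw [integral_coinSample hq0 hq1 (F := fun p => outcome p.2) (by fun_prop)]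
    simp [outcome]
  refine le_antisymm ?_ (le_csInf ((calibratedExtensions_nonempty _).image _) ?_)
  · refine (lowerDistCal_le_integral_meanOutcome _).trans_eq ?_
    rw [integral_coinSample hq0 hq1 (F := fun p => |(meanOutcome (coinSample q) : ℝ) - p.1|)
      (by fun_prop), coe_meanOutcome, hy]
    simp only [halfPrediction]
    ring
  · rintro _ ⟨Q, hQ, rfl⟩
    have := hQ.1
    have h1 := calibratedExtensions.integral_sub_mul_eq_zero hQ (g := fun _ => 1)
      measurable_const 1 (by simp)
    simp only [mul_one] at h1
    have hi1 : Integrable (fun p : I × I × Bool => outcome p.2.2) Q :=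
      integrable_of_forall_abs_le (by fun_prop) 1 fun p =>
        abs_le.2 ⟨by linarith [outcome_nonneg p.2.2], outcome_le_one _⟩
    have hi2 : Integrable (fun p : I × I × Bool => (p.1 : ℝ)) Q :=
      integrable_of_forall_abs_le (by fun_prop) 1 fun p =>
        abs_le.2 ⟨by linarith [p.1.2.1], p.1.2.2⟩
    have hi3 : Integrable (fun p : I × I × Bool => (p.2.1 : ℝ)) Q :=
      integrable_of_forall_abs_le (by fun_prop) 1 fun p =>
        abs_le.2 ⟨by linarith [p.2.1.2.1], p.2.1.2.2⟩
    have h2 : ∫ p : I × I × Bool, (p.2.1 : ℝ) ∂Q = 1 / 2 := by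
      rw [calibratedExtensions.integral_comp_snd hQ (g := fun p : Sample => (p.1 : ℝ))
          (by fun_prop),
        integral_coinSample hq0 hq1 (F := fun p => (p.1 : ℝ)) (by fun_prop)]
      simp only [halfPrediction]
      ring
    have h3 : ∫ p : I × I × Bool, outcome p.2.2 ∂Q = q := by
      rw [calibratedExtensions.integral_comp_snd hQ (g := fun p : Sample => outcome p.2)
        (by fun_prop), hy]
    rw [integral_sub hi1 hi2, h3] at h1
    have h4 : ∫ p : I × I × Bool, ((p.1 : ℝ) - p.2.1) ∂Q = q - 1 / 2 := by
      rw [integral_sub hi2 hi3, h2]; linarith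
    rw [← h4]
    exact abs_integral_le_integral_abs

/-- The probability of an answer on coin samples is a finite sum. -/
lemma toReal_bind_coinSample {n : ℕ} (κ : Kernel (Fin n → Sample) Bool) [IsMarkovKernel κ]
    (b : Bool) :
    (((Measure.pi fun _ : Fin n => coinSample q).bind κ) {b}).toReal =
      ∑ ω : Fin n → Bool, (∏ i, if ω i then q else 1 - q) *
        (κ fun i => (halfPrediction, ω i)).real {b} := by
  have := isProbabilityMeasure_coin hq0 hq1
  have := isProbabilityMeasure_coinSample hq0 hq1
  have hpi : (Measure.pi fun _ : Fin n => coinSample q) =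
      (Measure.pi fun _ : Fin n => coin q).map fun ω i => (halfPrediction, ω i) :=
    (Measure.pi_map_pi (μ := fun _ : Fin n => coin q) (f := fun _ y => (halfPrediction, y))
      fun i => (by fun_prop)).symm
  rw [Measure.bind_apply (measurableSet_singleton b) κ.aemeasurable, hpi,
    lintegral_map (κ.measurable_coe (measurableSet_singleton b)) (by fun_prop),
    lintegral_fintype, ENNReal.toReal_sum]
  · refine Finset.sum_congr rfl fun ω _ => ?_
    rw [ENNReal.toReal_mul, Measure.pi_singleton, ENNReal.toReal_prod, mul_comm]
    congr 1
    exact Finset.prod_congr rfl fun i _ => coin_singleton_toReal hq0 hq1 (ω i)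
  · intro ω _
    exact ENNReal.mul_ne_top (measure_ne_top _ _) (measure_ne_top _ _)

end Coin

/-- The second moment of the likelihood ratio between `n` coins of bias `1/2 + ε` and `n` fair
ones is `(1 + 4 ε²) ^ n`; a test between the two needs it to be bounded away from one. -/
lemma four_thirds_le_of_solves {n : ℕ} {ε : ℝ} (hε0 : 0 ≤ ε) (hε1 : ε ≤ 1 / 2)
    {κ : Kernel (Fin n → Sample) Bool} [IsMarkovKernel κ] (h : SolvesCalibrationTesting n ε κ) :
    4 / 3 ≤ (1 + 4 * ε ^ 2) ^ n := by
  set g : (Fin n → Bool) → ℝ := fun ω => (κ fun i => (halfPrediction, ω i)).real {false} with hg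
  have hg0 : ∀ ω, 0 ≤ g ω := fun ω => measureReal_nonneg
  have hg1 : ∀ ω, g ω ≤ 1 := fun ω => measureReal_le_one
  have hP0 := isProbabilityMeasure_coinSample (q := 1 / 2) (by norm_num) (by norm_num)
  have hP1 := isProbabilityMeasure_coinSample (q := 1 / 2 + ε) (by linarith) (by linarith)
  have h23 : (2 / 3 : ℝ≥0∞).toReal = 2 / 3 := by simp
  have hfar : 2 / 3 ≤ ∑ ω : Fin n → Bool, (∏ i, if ω i then 1 / 2 + ε else 1 / 2 - ε) * g ω := by
    have h1 := (h _ hP1).1 (by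
      rw [lowerDistCal_coinSample (by linarith) (by linarith), add_sub_cancel_left]
      exact le_abs_self _)
    have h2 := ENNReal.toReal_mono (measure_ne_top _ _) h1
    rw [toReal_bind_coinSample (by linarith) (by linarith), h23] at h2
    refine h2.trans_eq (Finset.sum_congr rfl fun ω _ => ?_)
    congr 1
    refine Finset.prod_congr rfl fun i _ => ?_
    split_ifs
    · rfl
    · ring
  have hfair : ∑ ω : Fin n → Bool, g ω ≤ 2 ^ n / 3 := by
    have h1 := (h _ hP0).2 (by
      rw [lowerDistCal_coinSample (by norm_num) (by norm_num)]; simp)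
    have h2 := ENNReal.toReal_mono (measure_ne_top _ _) h1
    rw [toReal_bind_coinSample (by norm_num) (by norm_num), h23] at h2
    have h3 : ∀ ω : Fin n → Bool, (∏ i, if ω i then (1 / 2 : ℝ) else 1 - 1 / 2) = 1 / 2 ^ n := by
      intro ω
      have : ∀ i, (if ω i then (1 / 2 : ℝ) else 1 - 1 / 2) = 1 / 2 := fun i => by
        split_ifs <;> norm_num
      rw [Finset.prod_congr rfl fun i _ => this i]
      simp
    have h4 : ∀ ω : Fin n → Bool, (κ fun i => (halfPrediction, ω i)).real {true} = 1 - g ω := by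
      intro ω
      have := probReal_compl_eq_one_sub (μ := κ fun i => (halfPrediction, ω i))
        (measurableSet_singleton false)
      rw [← this]
      congr 1
      ext b; cases b <;> simp
    simp_rw [h3, h4] at h2
    rw [← Finset.mul_sum, Finset.sum_sub_distrib] at h2
    simp only [Finset.sum_const, Finset.card_univ, Fintype.card_fun, Fintype.card_bool,
      Fintype.card_fin, nsmul_eq_mul, mul_one, Nat.cast_pow, Nat.cast_ofNat] at h2
    have h5 : (0 : ℝ) < 2 ^ n := by positivity
    rw [one_div, inv_mul_eq_div, le_div_iff₀ h5] at h2
    linarith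
  have hL : ∑ ω : Fin n → Bool, (∏ i, if ω i then 1 / 2 + ε else 1 / 2 - ε) ^ 2 =
      (1 + 4 * ε ^ 2) ^ n / 2 ^ n := by
    simp_rw [← Finset.prod_pow]
    have := Finset.prod_univ_sum (fun _ : Fin n => (Finset.univ : Finset Bool))
      (fun _ b => (if b then 1 / 2 + ε else 1 / 2 - ε) ^ 2)
    rw [Fintype.piFinset_univ] at this
    rw [← this, ← div_pow]
    simp only [Fintype.sum_bool, Finset.prod_const, Finset.card_univ, Fintype.card_fin]
    congr 1
    simp
    ring
  have hcs := Finset.sum_mul_sq_le_sq_mul_sq Finset.univ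
    (fun ω : Fin n → Bool => ∏ i, if ω i then 1 / 2 + ε else 1 / 2 - ε) g
  have hgsq : ∑ ω, g ω ^ 2 ≤ 2 ^ n / 3 :=
    (Finset.sum_le_sum fun ω _ => pow_le_of_le_one (hg0 ω) (hg1 ω) two_ne_zero).trans hfair
  rw [hL] at hcs
  have h6 : (0 : ℝ) < 2 ^ n := by positivity
  have h7 : (0 : ℝ) < (1 + 4 * ε ^ 2) ^ n / 2 ^ n := by positivity
  have h8 := hcs.trans (mul_le_mul_of_nonneg_left hgsq h7.le)
  have h9 : (1 + 4 * ε ^ 2) ^ n / 2 ^ n * (2 ^ n / 3) = (1 + 4 * ε ^ 2) ^ n / 3 := by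
    field_simp
  rw [h9] at h8
  nlinarith

/-- No decision rule does better than `1 / (4 √n)`. -/
theorem le_of_solvesCalibrationTesting {n : ℕ} (hn : 0 < n) {ε : ℝ} (hε0 : 0 < ε)
    {κ : Kernel (Fin n → Sample) Bool} [IsMarkovKernel κ] (h : SolvesCalibrationTesting n ε κ) :
    1 / (4 * √n) ≤ ε := by
  have hn1 : (1 : ℝ) ≤ n := by exact_mod_cast hn
  have hs : 1 ≤ √(n : ℝ) := Real.one_le_sqrt.2 hn1
  by_contra! hlt
  have hε1 : ε ≤ 1 / 2 := hlt.le.trans (one_div_le_one_div_of_le (by norm_num) (by linarith))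
  have h1 := four_thirds_le_of_solves hε0.le hε1 h
  have h2 : (1 + 4 * ε ^ 2) ^ n ≤ Real.exp (1 / 4) := by
    calc (1 + 4 * ε ^ 2) ^ n ≤ Real.exp (4 * ε ^ 2) ^ n := by
          refine pow_le_pow_left₀ (by positivity) ?_ n
          linarith [Real.add_one_le_exp (4 * ε ^ 2)]
      _ = Real.exp (n * (4 * ε ^ 2)) := (Real.exp_nat_mul _ _).symm
      _ ≤ Real.exp (1 / 4) := by
          refine Real.exp_le_exp.2 ?_
          have h3 : ε * (4 * √n) < 1 := (lt_div_iff₀ (by positivity)).1 hlt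
          have h4 : (ε * (4 * √n)) ^ 2 ≤ 1 := pow_le_one₀ (by positivity) h3.le
          rw [mul_pow, mul_pow, Real.sq_sqrt (by linarith)] at h4
          linarith
  have h3 : Real.exp (1 / 4) < 4 / 3 := by
    have h4 : Real.exp (1 / 4) ^ 4 = Real.exp 1 := by
      rw [← Real.exp_nat_mul]; norm_num
    by_contra! h5
    have h6 := pow_le_pow_left₀ (by norm_num) h5 4
    rw [h4] at h6
    linarith [Real.exp_one_lt_d9]
  linarith

/-! ### Total correctness with running times for the real RAM -/

namespace RealRAM

/-- On a machine with `b`-bit words, `p` started in `s` halts within `t` steps in a state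
satisfying `P`. -/
def Runs (b : ℕ) (p : Program) (s : State) (t : ℕ) (P : State → Prop) : Prop :=
  ∃ t' ≤ t, ∃ s', Exec b p s t' s' ∧ P s'

lemma Runs.mono {b : ℕ} {p : Program} {s : State} {t t' : ℕ} {P P' : State → Prop}
    (h : Runs b p s t P) (ht : t ≤ t') (hP : ∀ s', P s' → P' s') : Runs b p s t' P' := by
  obtain ⟨t₀, ht₀, s', he, hs'⟩ := h
  exact ⟨t₀, ht₀.trans ht, s', he, hP _ hs'⟩

lemma Runs.seq {b : ℕ} {p q : Program} {s : State} {t t' : ℕ} {P P' : State → Prop}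
    (hp : Runs b p s t P) (hq : ∀ s', P s' → Runs b q s' t' P') :
    Runs b (.seq p q) s (t + t') P' := by
  obtain ⟨t₁, ht₁, s₁, he₁, hs₁⟩ := hp
  obtain ⟨t₂, ht₂, s₂, he₂, hs₂⟩ := hq s₁ hs₁
  exact ⟨t₁ + t₂, add_le_add ht₁ ht₂, s₂, .seq he₁ he₂, hs₂⟩

lemma Runs.ite {b : ℕ} {c : Test} {p q : Program} {s : State} {t : ℕ} {P : State → Prop}
    (hp : c.Holds s → Runs b p s t P) (hq : ¬ c.Holds s → Runs b q s t P) :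
    Runs b (.ite c p q) s (t + 1) P := by
  by_cases hc : c.Holds s
  · obtain ⟨t₁, ht₁, s₁, he₁, hs₁⟩ := hp hc
    exact ⟨t₁ + 1, by omega, s₁, .iteTrue hc he₁, hs₁⟩
  · obtain ⟨t₁, ht₁, s₁, he₁, hs₁⟩ := hq hc
    exact ⟨t₁ + 1, by omega, s₁, .iteFalse hc he₁, hs₁⟩

/-- The loop rule. The number `k` in the invariant bounds the number of iterations still to come. -/
lemma Runs.loop {b : ℕ} {c : Test} {p : Program} {t : ℕ} {inv : ℕ → State → Prop}
    (hstep : ∀ k s, inv k s → c.Holds s → ∃ k', k = k' + 1 ∧ Runs b p s t (inv k')) :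
    ∀ k s, inv k s →
      Runs b (.loop c p) s (k * (t + 1) + 1) fun s' => ¬ c.Holds s' ∧ ∃ k', inv k' s' := by
  intro k
  induction k with
  | zero =>
    intro s hs
    by_cases hc : c.Holds s
    · obtain ⟨k', hk', -⟩ := hstep 0 s hs hc
      omega
    · exact ⟨1, by omega, s, .loopDone hc, hc, 0, hs⟩
  | succ k ih =>
    intro s hs
    by_cases hc : c.Holds s
    · obtain ⟨k', hk', t₁, ht₁, s₁, he₁, hs₁⟩ := hstep _ s hs hc
      obtain rfl : k = k' := by omega
      obtain ⟨t₂, ht₂, s₂, he₂, hs₂⟩ := ih s₁ hs₁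
      refine ⟨t₁ + t₂ + 1, ?_, s₂, .loopStep hc he₁ he₂, hs₂⟩
      rw [Nat.succ_mul]
      omega
    · exact ⟨1, by omega, s, .loopDone hc, hc, _, hs⟩

/-- The weakest precondition of a loop-free program. -/
def Program.wp (b : ℕ) : Program → (State → Prop) → State → Prop
  | .skip, P, s => P s
  | .instr a, P, s => a.Fits b s ∧ P (a.run s)
  | .seq p q, P, s => p.wp b (q.wp b P) s
  | .ite c p q, P, s => (c.Holds s → p.wp b P s) ∧ (¬ c.Holds s → q.wp b P s)
  | .loop _ _, _, _ => False

/-- A bound on the running time of a loop-free program. -/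
def Program.cost : Program → ℕ
  | .skip => 1
  | .instr _ => 1
  | .seq p q => p.cost + q.cost
  | .ite _ p q => max p.cost q.cost + 1
  | .loop _ _ => 0

lemma runs_of_wp {b : ℕ} (p : Program) {P : State → Prop} {s : State} (h : p.wp b P s) :
    Runs b p s p.cost P := by
  induction p generalizing P s with
  | skip => exact ⟨1, le_rfl, s, .skip s, h⟩
  | instr a => exact ⟨1, le_rfl, _, .instr a s h.1, h.2⟩
  | seq p q ihp ihq => exact (ihp h).seq fun s' hs' => ihq hs'
  | ite c p q ihp ihq =>
    exact Runs.ite (fun hc => (ihp (h.1 hc)).mono (le_max_left _ _) fun _ h => h)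
      fun hc => (ihq (h.2 hc)).mono (le_max_right _ _) fun _ h => h
  | loop c p => exact h.elim

/-- A sequence of instructions. -/
def block : List Instr → Program
  | [] => .skip
  | a :: l => .seq (.instr a) (block l)

/-! ### The tester as a program -/

/-! The word registers hold `0`: the number of samples, `1`: a counter, `2`, `3`: the ends of the
interval of the binary search, `4`: its midpoint, `5`, `6`, `9`: the constants `1`, `2`, `0`,
`7`: the length of the interval, `8`: an outcome. The real registers hold `0`: the scaled
prediction, `1`: the number of samples, `2`, `3`: temporary values, `4`: a cumulative bias, `5`: the
sum of the absolute values of the cumulative biases, `6`: the constant `0`. The real array `1` holds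
the total bias of each cell. -/

/-- Decide on the first sample alone. -/
def firstSampleProgram : Program :=
  .seq (block [.rload 0 0 2, .wload 8 0 2, .rword 1 8, .rop .sub 0 1 0, .rop .mul 0 0 0,
      .rconst 1 (81 / 100)])
    (.ite (.rlt 0 1) (block [.wconst 0 1]) (block [.wconst 0 0]))

/-- Halve the interval that contains the scaled prediction. -/
def bisectionStep : Program :=
  .seq (block [.wop .add 4 2 3, .wop .div 4 4 6, .rword 2 4])
    (.seq (.ite (.rle 2 0) (block [.wop .add 2 4 9]) (block [.wop .add 3 4 9]))
      (block [.wop .sub 7 3 2]))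

/-- Find the cell of a prediction by bisection. -/
def bisection : Program := .loop (.wlt 5 7) bisectionStep

/-- Prepare the search for the cell of the current sample. -/
def loadSample : Program :=
  block [.rload 0 0 1, .rop .mul 0 0 1, .wconst 2 0, .wop .add 3 0 5, .wop .sub 7 3 2]

/-- Add the bias of the current sample to its cell. -/
def addSample : Program :=
  block [.wload 8 0 1, .rword 3 8, .rop .mul 3 3 1, .rword 2 2, .rop .sub 3 3 2, .rload 2 1 2,
    .rop .add 3 3 2, .rstore 1 2 3, .wop .add 1 1 5]

/-- Distribute the samples to the cells. -/
def bucketLoop : Program :=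
  .loop (.wlt 1 0) (.seq loadSample (.seq bisection addSample))

/-- Add the next cell to the cumulative bias, and its absolute value to the sum. -/
def sumStep : Program :=
  .seq (block [.rload 2 1 1, .rop .add 4 4 2])
    (.seq (.ite (.rlt 4 6) (block [.rop .sub 3 6 4]) (block [.rop .add 3 4 6]))
      (block [.rop .add 5 5 3, .wop .add 1 1 5]))

/-- Sum the absolute values of the cumulative biases. -/
def sumLoop : Program := .loop (.wlt 1 3) sumStep

/-- Compare the square of the statistic with its threshold. -/
def compareProgram : Program :=
  .seq (block [.rop .mul 3 3 1, .rop .add 5 5 3, .rop .mul 5 5 5, .rconst 2 169, .rop .mul 2 2 1,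
      .rop .mul 2 2 1, .rop .mul 2 2 1, .rop .mul 2 2 1, .rop .mul 2 2 1])
    (.ite (.rle 5 2) (block [.wconst 0 1]) (block [.wconst 0 0]))

/-- Decide with the grid statistic. -/
def gridProgram : Program :=
  .seq (block [.wconst 1 0, .wconst 5 1, .wconst 6 2, .rword 1 0])
    (.seq bucketLoop
      (.seq (block [.wconst 1 0, .wop .add 3 0 5, .rconst 3 0, .rconst 4 0, .rconst 5 0])
        (.seq sumLoop compareProgram)))

/-- The tester: below `2500` samples, where `45 / √n` may exceed `1`, only the first one is used. -/
def testerProgram : Program :=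
  .seq (block [.wconst 1 2500]) (.ite (.wlt 0 1) firstSampleProgram gridProgram)

/-- The cell of the prediction at address `i`. -/
noncomputable def cellAt (n : ℕ) (V : ℕ → ℝ) (i : ℕ) : ℕ := ⌊V i * n⌋₊

/-- The total bias, scaled by `n`, in the cell `j` of the first `i` samples. -/
noncomputable def cellTotal (n : ℕ) (V : ℕ → ℝ) (Y : ℕ → ℕ) (i j : ℕ) : ℝ :=
  ∑ l ∈ Finset.range i, if j = cellAt n V l then (Y l : ℝ) * n - cellAt n V l else 0

/-- The cumulative bias, scaled by `n ^ 2`, of the first `j` cells. -/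
noncomputable def cumTotal (n : ℕ) (V : ℕ → ℝ) (Y : ℕ → ℕ) (j : ℕ) : ℝ :=
  ∑ l ∈ Finset.range j, cellTotal n V Y n l

/-- The registers and arrays that stay constant while the grid statistic is computed. -/
structure Env (n : ℕ) (V : ℕ → ℝ) (Y : ℕ → ℕ) (s : State) : Prop where
  w0 : s.wreg 0 = n
  w5 : s.wreg 5 = 1
  w6 : s.wreg 6 = 2
  w9 : s.wreg 9 = 0
  r1 : s.rreg 1 = n
  r6 : s.rreg 6 = 0
  rarr0 : s.rarr 0 = V
  warr0 : s.warr 0 = Y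

section Correctness

variable {b n : ℕ} {V : ℕ → ℝ} {Y : ℕ → ℕ}

lemma runs_bisection (hb : 2 * n + 2 < 2 ^ b) {i : ℕ} {B : ℕ → ℝ} {τ : ℝ} (s : State)
    (hE : Env n V Y s) (h1 : s.wreg 1 = i) (hB : s.rarr 1 = B) (hr0 : s.rreg 0 = τ)
    (h2 : s.wreg 2 = 0) (h3 : s.wreg 3 = n + 1) (h7 : s.wreg 7 = n + 1) (hτ0 : 0 ≤ τ)
    (hτn : τ ≤ n) :
    Runs b bisection s (10 * n.size + 1) fun s' =>
      Env n V Y s' ∧ s'.wreg 1 = i ∧ s'.rarr 1 = B ∧ s'.wreg 2 = ⌊τ⌋₊ := by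
  let inv : ℕ → State → Prop := fun k s => Env n V Y s ∧ s.wreg 1 = i ∧ s.rarr 1 = B ∧
    s.rreg 0 = τ ∧ s.wreg 2 < s.wreg 3 ∧ s.wreg 3 ≤ n + 1 ∧ s.wreg 7 = s.wreg 3 - s.wreg 2 ∧
    s.wreg 3 ≤ s.wreg 2 + 2 ^ k ∧ (s.wreg 2 : ℝ) ≤ τ ∧ τ < s.wreg 3
  have hstep : ∀ k s, inv k s → Test.Holds (.wlt 5 7) s →
      ∃ k', k = k' + 1 ∧ Runs b bisectionStep s 9 (inv k') := by
    rintro k s ⟨hE, h1, hB, hr0, h23, h3, h7, hk, hlo, hhi⟩ hc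
    have hc' : 1 < s.wreg 7 := by simpa [Test.Holds, hE.w5] using hc
    obtain ⟨k', rfl⟩ : ∃ k', k = k' + 1 := by
      refine ⟨k - 1, ?_⟩
      rcases k with - | k
      · rw [pow_zero] at hk; omega
      · rfl
    refine ⟨k', rfl, (runs_of_wp _ ?_).mono (t := Program.cost bisectionStep) (by decide)
      fun _ h => h⟩
    rw [pow_succ] at hk
    have hw6 := hE.w6
    have hw9 := hE.w9
    have hlt : (s.wreg 2 + s.wreg 3) / 2 < 2 ^ b := by omega
    have hfit : s.wreg 2 + s.wreg 3 < 2 ^ b := by omega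
    have hfit' : s.wreg 3 - (s.wreg 2 + s.wreg 3) / 2 < 2 ^ b := by omega
    have hfit'' : (s.wreg 2 + s.wreg 3) / 2 - s.wreg 2 < 2 ^ b := by omega
    simp only [bisectionStep, block, Program.wp, Instr.Fits, Instr.run, WordOp.eval, Test.Holds,
      Function.update_apply, hw6, hw9]
    norm_num [hfit, hlt]
    refine ⟨fun hle => ⟨hfit', ?_⟩, fun hgt => ⟨hfit'', ?_⟩⟩
    · rw [hr0] at hle
      refine ⟨⟨?_, ?_, ?_, ?_, ?_, ?_, ?_, ?_⟩, ?_, ?_, ?_, ?_, ?_, ?_, ?_, ?_, ?_⟩ <;>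
        simp [hE.w0, hE.w5, hE.w6, hE.w9, hE.r1, hE.r6, hE.rarr0, hE.warr0, h1, hB, hr0, h3, hle,
          hhi]
      · omega
      · omega
    · rw [hr0] at hgt
      refine ⟨⟨?_, ?_, ?_, ?_, ?_, ?_, ?_, ?_⟩, ?_, ?_, ?_, ?_, ?_, ?_, ?_, ?_, ?_⟩ <;>
        simp [hE.w0, hE.w5, hE.w6, hE.w9, hE.r1, hE.r6, hE.rarr0, hE.warr0, h1, hB, hr0, hlo, hgt]
      · omega
      · omega
      · omega
  have hinit : inv n.size s := by
    refine ⟨hE, h1, hB, hr0, by omega, by omega, by omega, ?_, by simpa [h2] using hτ0, ?_⟩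
    · have := Nat.lt_size_self n
      omega
    · rw [h3]; push_cast; linarith
  refine (Runs.loop hstep _ s hinit).mono (by omega) ?_
  rintro s' ⟨hc, k, hE, h1, hB, hr0, h23, h3, h7, hk, hlo, hhi⟩
  refine ⟨hE, h1, hB, ?_⟩
  have hc' : s'.wreg 7 ≤ 1 := by simpa [Test.Holds, hE.w5] using hc
  have h32 : s'.wreg 3 = s'.wreg 2 + 1 := by omega
  rw [eq_comm, Nat.floor_eq_iff hτ0]
  refine ⟨hlo, ?_⟩
  rw [h32] at hhi
  exact_mod_cast hhi

lemma runs_bucketLoop (hb : 2 * n + 2 < 2 ^ b) (hV : ∀ i < n, V i ∈ Set.Icc (0 : ℝ) 1)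
    (s : State) (hE : Env n V Y s) (h1 : s.wreg 1 = 0) (hB : s.rarr 1 = fun _ => 0) :
    Runs b bucketLoop s (n * (10 * n.size + 20) + 1) fun s' =>
      Env n V Y s' ∧ s'.rarr 1 = cellTotal n V Y n := by
  let inv : ℕ → State → Prop := fun k s => ∃ i, i + k = n ∧ Env n V Y s ∧ s.wreg 1 = i ∧
    s.rarr 1 = cellTotal n V Y i
  have hstep : ∀ k s, inv k s → Test.Holds (.wlt 1 0) s → ∃ k', k = k' + 1 ∧
      Runs b (.seq loadSample (.seq bisection addSample)) s (10 * n.size + 19) (inv k') := by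
    rintro k s ⟨i, hik, hE, h1, hB⟩ hc
    have hin : i < n := by simpa [Test.Holds, hE.w0, h1] using hc
    obtain ⟨k', rfl⟩ : ∃ k', k = k' + 1 := ⟨k - 1, by omega⟩
    refine ⟨k', rfl, ?_⟩
    have hVi := hV i hin
    have hload : Runs b loadSample s (Program.cost loadSample) fun s => Env n V Y s ∧
        s.wreg 1 = i ∧ s.rarr 1 = cellTotal n V Y i ∧ s.rreg 0 = V i * n ∧ s.wreg 2 = 0 ∧
        s.wreg 3 = n + 1 ∧ s.wreg 7 = n + 1 := by
      refine runs_of_wp _ ?_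
      have hf : n + 1 < 2 ^ b := by omega
      simp only [loadSample, block, Program.wp, Instr.Fits, Instr.run, WordOp.eval, RealOp.eval,
        Function.update_apply]
      norm_num [hE.w0, hE.w5, hE.r1, hE.rarr0, h1, hf, hB]
      constructor <;>
        simp [hE.w0, hE.w5, hE.w6, hE.w9, hE.r1, hE.r6, hE.rarr0, hE.warr0]
    have hadd : ∀ s, (Env n V Y s ∧ s.wreg 1 = i ∧ s.rarr 1 = cellTotal n V Y i ∧
        s.wreg 2 = ⌊V i * n⌋₊) → Runs b addSample s (Program.cost addSample) (inv k') := by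
      rintro s ⟨hE, h1, hB, h2⟩
      refine runs_of_wp _ ?_
      have hf : i + 1 < 2 ^ b := by omega
      simp only [addSample, block, Program.wp, Instr.Fits, Instr.run, WordOp.eval, RealOp.eval,
        Function.update_apply]
      norm_num [hE.w5, hE.r1, hE.warr0, h1, hf, hB, h2]
      refine ⟨i + 1, by omega, ?_, by simp, ?_⟩
      · constructor <;>
          simp [hE.w0, hE.w5, hE.w6, hE.w9, hE.r1, hE.r6, hE.rarr0, hE.warr0]
      · funext j
        simp only [Function.update_self, Function.update_apply, cellTotal, cellAt,
          Finset.sum_range_succ]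
        by_cases hj : j = ⌊V i * n⌋₊
        · simp only [hj, if_true]
          exact add_comm _ _
        · simp [hj]
    refine ((hload.seq fun s hs => (runs_bisection hb (τ := V i * n) s hs.1 hs.2.1 hs.2.2.1
      hs.2.2.2.1 hs.2.2.2.2.1 hs.2.2.2.2.2.1 hs.2.2.2.2.2.2
      (mul_nonneg hVi.1 (Nat.cast_nonneg _))
      (mul_le_of_le_one_left (Nat.cast_nonneg _) hVi.2)).seq hadd)).mono ?_ fun _ h => h
    simp only [loadSample, addSample, block, Program.cost]
    omega
  have hinit : inv n s := ⟨0, by omega, hE, h1, by rw [hB]; funext j; simp [cellTotal]⟩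
  refine (Runs.loop hstep _ s hinit).mono le_rfl ?_
  rintro s' ⟨hc, k, i, hik, hE, h1, hB⟩
  have hin : ¬ i < n := by simpa [Test.Holds, hE.w0, h1] using hc
  obtain rfl : i = n := by omega
  exact ⟨hE, hB⟩

lemma runs_sumLoop (hb : 2 * n + 2 < 2 ^ b) (s : State) (hE : Env n V Y s) (h1 : s.wreg 1 = 0)
    (h3 : s.wreg 3 = n + 1) (hB : s.rarr 1 = cellTotal n V Y n) (hr3 : s.rreg 3 = 0)
    (hr4 : s.rreg 4 = 0) (hr5 : s.rreg 5 = 0) :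
    Runs b sumLoop s ((n + 1) * 12 + 1) fun s' => Env n V Y s' ∧
      s'.rreg 3 = |cumTotal n V Y (n + 1)| ∧
      s'.rreg 5 = ∑ j ∈ Finset.range (n + 1), |cumTotal n V Y (j + 1)| := by
  let inv : ℕ → State → Prop := fun k s => ∃ i, i + k = n + 1 ∧ Env n V Y s ∧ s.wreg 1 = i ∧
    s.wreg 3 = n + 1 ∧ s.rarr 1 = cellTotal n V Y n ∧ s.rreg 3 = |cumTotal n V Y i| ∧
    s.rreg 4 = cumTotal n V Y i ∧ s.rreg 5 = ∑ j ∈ Finset.range i, |cumTotal n V Y (j + 1)|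
  have hstep : ∀ k s, inv k s → Test.Holds (.wlt 1 3) s → ∃ k', k = k' + 1 ∧
      Runs b sumStep s 11 (inv k') := by
    rintro k s ⟨i, hik, hE, h1, h3, hB, hr3, hr4, hr5⟩ hc
    have hin : i < n + 1 := by simpa [Test.Holds, h3, h1] using hc
    obtain ⟨k', rfl⟩ : ∃ k', k = k' + 1 := ⟨k - 1, by omega⟩
    refine ⟨k', rfl, (runs_of_wp _ ?_).mono (t := Program.cost sumStep) (by decide)
      fun _ h => h⟩
    have hf : i + 1 < 2 ^ b := by omega
    have hsucc : cumTotal n V Y i + cellTotal n V Y n i = cumTotal n V Y (i + 1) := by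
      rw [cumTotal, cumTotal, Finset.sum_range_succ]
    simp only [sumStep, block, Program.wp, Instr.Fits, Instr.run, WordOp.eval, RealOp.eval,
      Test.Holds, Function.update_apply]
    norm_num [hE.w5, hE.r6, h1, hf, hB, hr4, hr5, hsucc]
    refine ⟨fun hneg => ⟨i + 1, by omega, ?_, ?_, ?_, ?_, ?_, ?_, ?_⟩,
      fun hpos => ⟨i + 1, by omega, ?_, ?_, ?_, ?_, ?_, ?_, ?_⟩⟩
    all_goals first
      | (constructor <;> simp [hE.w0, hE.w5, hE.w6, hE.w9, hE.r1, hE.r6, hE.rarr0, hE.warr0])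
      | (simp [h3, hB, Finset.sum_range_succ, abs_of_neg, hneg])
      | (simp [h3, hB, Finset.sum_range_succ, abs_of_nonneg, hpos])
  have hinit : inv (n + 1) s := ⟨0, by omega, hE, h1, h3, hB, by simp [hr3, cumTotal],
    by simp [hr4, cumTotal], by simp [hr5]⟩
  refine (Runs.loop hstep _ s hinit).mono le_rfl ?_
  rintro s' ⟨hc, k, i, hik, hE, h1, h3, hB, hr3, hr4, hr5⟩
  have hin : ¬ i < n + 1 := by simpa [Test.Holds, h3, h1] using hc
  obtain rfl : i = n + 1 := by omega
  exact ⟨hE, hr3, hr5⟩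

open Classical in
lemma runs_gridProgram (hb : 2 * n + 2 < 2 ^ b) (hV : ∀ i < n, V i ∈ Set.Icc (0 : ℝ) 1)
    (s : State) (h0 : s.wreg 0 = n) (h9 : s.wreg 9 = 0) (h6 : s.rreg 6 = 0)
    (hrarr : s.rarr 0 = V) (hwarr : s.warr 0 = Y) (hB : s.rarr 1 = fun _ => 0) :
    Runs b gridProgram s (n * (10 * n.size + 20) + 12 * n + 40) fun s' =>
      s'.wreg 0 = if (|cumTotal n V Y (n + 1)| * n +
        ∑ j ∈ Finset.range (n + 1), |cumTotal n V Y (j + 1)|) ^ 2 ≤ 169 * (n : ℝ) ^ 5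
        then 1 else 0 := by
  have hinit : Runs b (block [.wconst 1 0, .wconst 5 1, .wconst 6 2, .rword 1 0]) s 5 fun s =>
      Env n V Y s ∧ s.wreg 1 = 0 ∧ s.rarr 1 = fun _ => 0 := by
    refine runs_of_wp _ ?_
    have hf : 2 < 2 ^ b := by
      rcases n with - | n
      · by_contra! h
        have : 2 ^ b = 1 ∨ 2 ^ b = 2 := by have := Nat.two_pow_pos b; omega
        omega
      · omega
    simp only [block, Program.wp, Instr.Fits, Instr.run, Function.update_apply]
    norm_num [hf, hB, show 1 < 2 ^ b by omega]
    constructor <;> simp [h0, h9, h6, hrarr, hwarr]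
  have hreset : ∀ s, (Env n V Y s ∧ s.rarr 1 = cellTotal n V Y n) →
      Runs b (block [.wconst 1 0, .wop .add 3 0 5, .rconst 3 0, .rconst 4 0, .rconst 5 0]) s 6
        fun s => Env n V Y s ∧ s.wreg 1 = 0 ∧ s.wreg 3 = n + 1 ∧ s.rarr 1 = cellTotal n V Y n ∧
          s.rreg 3 = 0 ∧ s.rreg 4 = 0 ∧ s.rreg 5 = 0 := by
    rintro s ⟨hE, hB⟩
    refine runs_of_wp _ ?_
    have hf : n + 1 < 2 ^ b := by omega
    simp only [block, Program.wp, Instr.Fits, Instr.run, WordOp.eval, Function.update_apply]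
    norm_num [hf, hB, hE.w0, hE.w5]
    constructor <;> simp [hE.w0, hE.w5, hE.w6, hE.w9, hE.r1, hE.r6, hE.rarr0, hE.warr0]
  have hcmp : ∀ s, (Env n V Y s ∧ s.rreg 3 = |cumTotal n V Y (n + 1)| ∧
      s.rreg 5 = ∑ j ∈ Finset.range (n + 1), |cumTotal n V Y (j + 1)|) →
      Runs b compareProgram s 13 fun s' =>
        s'.wreg 0 = if (|cumTotal n V Y (n + 1)| * n +
          ∑ j ∈ Finset.range (n + 1), |cumTotal n V Y (j + 1)|) ^ 2 ≤ 169 * (n : ℝ) ^ 5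
          then 1 else 0 := by
    rintro s ⟨hE, hr3, hr5⟩
    refine runs_of_wp _ ?_
    have hf : 1 < 2 ^ b := by omega
    set Z := |cumTotal n V Y (n + 1)| * n + ∑ j ∈ Finset.range (n + 1), |cumTotal n V Y (j + 1)|
      with hZ
    have hZ' : (∑ j ∈ Finset.range (n + 1), |cumTotal n V Y (j + 1)|) +
      |cumTotal n V Y (n + 1)| * n = Z := by rw [hZ]; ring
    have hp : 169 * (n : ℝ) * n * n * n * n = 169 * (n : ℝ) ^ 5 := by ring
    simp only [compareProgram, block, Program.wp, Instr.Fits, Instr.run, RealOp.eval, Test.Holds,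
      Function.update_apply]
    norm_num [hE.r1, hr3, hr5, hf, hZ', hp, ← sq]
  refine (hinit.seq fun s hs => (runs_bucketLoop hb hV s hs.1 hs.2.1 hs.2.2).seq fun s hs =>
    (hreset s hs).seq fun s hs => (runs_sumLoop hb s hs.1 hs.2.1 hs.2.2.1 hs.2.2.2.1
      hs.2.2.2.2.1 hs.2.2.2.2.2.1 hs.2.2.2.2.2.2).seq hcmp).mono ?_ fun _ h => h
  omega

end Correctness

/-! ### The program computes the two decision rules -/

section Answers

variable {n : ℕ} (x : Fin n → Sample)

lemma initState_rarr_zero (i : Fin n) : (initState x).rarr 0 i = (x i).1 := by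
  simp [initState]

lemma initState_warr_zero (i : Fin n) : ((initState x).warr 0 i : ℝ) = outcome (x i).2 := by
  cases h : (x i).2 <;> simp [initState, outcome, h]

lemma cumTotal_initState (hn : 0 < n) (j : ℕ) :
    cumTotal n ((initState x).rarr 0) ((initState x).warr 0) (j + 1) =
      n ^ 2 * empCumBias x n j := by
  have hn' : (n : ℝ) ≠ 0 := Nat.cast_ne_zero.2 hn.ne'
  have hcell : ∀ i : Fin n, cellAt n ((initState x).rarr 0) i = gridCell n (x i).1 := fun i => by
    rw [cellAt, initState_rarr_zero, gridCell]
  have h1 : ∀ l, cellTotal n ((initState x).rarr 0) ((initState x).warr 0) n l =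
      ∑ i : Fin n, if l = gridCell n (x i).1 then
        outcome (x i).2 * n - gridCell n (x i).1 else 0 := by
    intro l
    rw [cellTotal, ← Fin.sum_univ_eq_sum_range (fun i =>
      if l = cellAt n ((initState x).rarr 0) i then
        ((initState x).warr 0 i : ℝ) * n - cellAt n ((initState x).rarr 0) i else 0)]
    simp_rw [hcell, initState_warr_zero]
  simp_rw [cumTotal, h1]
  rw [Finset.sum_comm, empCumBias, Finset.mul_sum, Finset.mul_sum]
  refine Finset.sum_congr rfl fun i _ => ?_
  rw [Finset.sum_ite_eq', cellBias]
  simp only [Finset.mem_range, Nat.lt_succ_iff]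
  split_ifs
  · field_simp
  · simp

/-- The comparison of the program is that of the rule, multiplied by `n ^ 3` and squared. -/
lemma sq_le_iff_gridNorm_le (hn : 0 < n) :
    (|cumTotal n ((initState x).rarr 0) ((initState x).warr 0) (n + 1)| * n +
      ∑ j ∈ Finset.range (n + 1),
        |cumTotal n ((initState x).rarr 0) ((initState x).warr 0) (j + 1)|) ^ 2 ≤
      169 * (n : ℝ) ^ 5 ↔ gridNorm n (empCumBias x n) ≤ 13 / √n := by
  have hn' : (0 : ℝ) < n := Nat.cast_pos.2 hn
  have hs : 0 < √(n : ℝ) := Real.sqrt_pos.2 hn'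
  have hZ : |cumTotal n ((initState x).rarr 0) ((initState x).warr 0) (n + 1)| * n +
      ∑ j ∈ Finset.range (n + 1),
        |cumTotal n ((initState x).rarr 0) ((initState x).warr 0) (j + 1)| =
      n ^ 3 * gridNorm n (empCumBias x n) := by
    simp_rw [cumTotal_initState x hn, abs_mul, abs_of_pos (by positivity : (0 : ℝ) < (n : ℝ) ^ 2)]
    rw [← Finset.mul_sum, gridNorm]
    field_simp
  have hN : 0 ≤ gridNorm n (empCumBias x n) := by unfold gridNorm; positivity
  have hR : 169 * (n : ℝ) ^ 5 = (n ^ 3 * (13 / √n)) ^ 2 := by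
    rw [mul_pow, div_pow, Real.sq_sqrt hn'.le]
    field_simp
    norm_num
  rw [hZ, hR, pow_le_pow_iff_left₀ (by positivity) (by positivity) two_ne_zero,
    mul_le_mul_iff_right₀ (by positivity)]

/-- The decision rule of the tester. -/
noncomputable def testerRule (hn : 0 < n) : (Fin n → Sample) → Bool :=
  if n < 2500 then oneSampleRule hn else gridRule

lemma runs_firstSampleProgram {b : ℕ} (hb : 2500 < 2 ^ b) (hn : 0 < n) (s : State)
    (h2 : s.wreg 2 = 0) (hrarr : s.rarr 0 = (initState x).rarr 0)
    (hwarr : s.warr 0 = (initState x).warr 0) :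
    Runs b firstSampleProgram s 10 fun s' => s'.wreg 0 = (oneSampleRule hn x).toNat := by
  refine runs_of_wp _ ?_
  have hf : 1 < 2 ^ b := by omega
  have hv : (initState x).rarr 0 0 = (x ⟨0, hn⟩).1 := initState_rarr_zero x ⟨0, hn⟩
  have hy : ((initState x).warr 0 0 : ℝ) = outcome (x ⟨0, hn⟩).2 := initState_warr_zero x ⟨0, hn⟩
  simp only [firstSampleProgram, block, Program.wp, Instr.Fits, Instr.run, RealOp.eval, Test.Holds,
    Function.update_apply]
  norm_num [h2, hrarr, hwarr, hf, hv, hy, ← sq]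
  exact ⟨fun h => by simp [oneSampleRule, h], fun h => by simp [oneSampleRule, not_lt.2 h]⟩

theorem answersWithin_testerProgram (hn : 0 < n) :
    AnswersWithin (12 * n.size) testerProgram x (n * (10 * n.size + 20) + 12 * n + 50)
      (testerRule hn x) := by
  have hlt := Nat.lt_size_self n
  have hsz : 1 ≤ n.size := Nat.size_pos.2 hn
  have hb : 2 ^ 11 * 2 ^ n.size ≤ 2 ^ (12 * n.size) := by
    rw [← pow_add]
    exact Nat.pow_le_pow_right (by norm_num) (by omega)
  have hb0 : 2 ≤ 2 ^ n.size := Nat.le_self_pow (by omega) 2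
  have hb1 : 2500 < 2 ^ (12 * n.size) := by omega
  have hb2 : 2 * n + 2 < 2 ^ (12 * n.size) := by omega
  have hpre : Runs (12 * n.size) (block [.wconst 1 2500]) (initState x) 2 fun s =>
      s.wreg 0 = n ∧ s.wreg 1 = 2500 ∧ s.wreg 2 = 0 ∧ s.wreg 9 = 0 ∧ s.rreg 6 = 0 ∧
        s.rarr 0 = (initState x).rarr 0 ∧ s.warr 0 = (initState x).warr 0 ∧
        s.rarr 1 = fun _ => 0 := by
    refine runs_of_wp _ ?_
    simp only [block, Program.wp, Instr.Fits, Instr.run, Function.update_apply]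
    simp [hb1, initState]
  have hV : ∀ i < n, (initState x).rarr 0 i ∈ Set.Icc (0 : ℝ) 1 := fun i hi => by
    rw [initState_rarr_zero x ⟨i, hi⟩]
    exact (x ⟨i, hi⟩).1.2
  have hmain : Runs (12 * n.size) testerProgram (initState x)
      (2 + (n * (10 * n.size + 20) + 12 * n + 40 + 1))
      fun s => s.wreg 0 = (testerRule hn x).toNat := by
    refine hpre.seq ?_
    rintro s ⟨h0, h1, h2, h9, h6, hrarr, hwarr, hB⟩
    refine Runs.ite (fun hc => ?_) (fun hc => ?_)
    · have hlt : n < 2500 := by simpa [Test.Holds, h0, h1] using hc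
      rw [testerRule, if_pos hlt]
      exact (runs_firstSampleProgram x hb1 hn s h2 hrarr hwarr).mono (by omega) fun _ h => h
    · have hlt : ¬ n < 2500 := by simpa [Test.Holds, h0, h1] using hc
      rw [testerRule, if_neg hlt]
      refine (runs_gridProgram hb2 hV s h0 h9 h6 hrarr hwarr hB).mono le_rfl fun s' hs' => ?_
      rw [hs']
      by_cases h : gridNorm n (empCumBias x n) ≤ 13 / √n
      · rw [if_pos ((sq_le_iff_gridNorm_le x hn).2 h)]; simp [gridRule, h]
      · rw [if_neg fun h' => h ((sq_le_iff_gridNorm_le x hn).1 h')]; simp [gridRule, h]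
  obtain ⟨t, ht, s, he, hs⟩ := hmain
  exact ⟨t, s, by omega, he, hs⟩

end Answers

end RealRAM

/-! ### The threshold and the tester -/

lemma testingThreshold_le {n : ℕ} {ε : ℝ} (hε : ε ∈ Set.Ioo (0 : ℝ) 1)
    {κ : Kernel (Fin n → Sample) Bool} [IsMarkovKernel κ] (h : SolvesCalibrationTesting n ε κ) :
    testingThreshold n ≤ ε :=
  csInf_le ⟨0, fun _ h => h.1.1.le⟩ ⟨hε, κ, inferInstance, h⟩

lemma le_testingThreshold {n : ℕ} (hn : 0 < n) : 1 / (4 * √n) ≤ testingThreshold n := by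
  refine le_csInf ⟨99 / 100, ⟨by norm_num, by norm_num⟩, _, inferInstance,
    solvesCalibrationTesting_oneSampleRule hn⟩ ?_
  rintro ε ⟨hε, κ, hκ, h⟩
  exact le_of_solvesCalibrationTesting hn hε.1 h

/-- The accuracy of the tester. The bound `45 / √n` is used once it is less than `1`. -/
noncomputable def testerAccuracy (n : ℕ) : ℝ := if n < 2500 then 99 / 100 else 45 / √n

lemma testerAccuracy_mem (n : ℕ) : testerAccuracy n ∈ Set.Ioo (0 : ℝ) 1 := by
  unfold testerAccuracy
  split_ifs with h
  · norm_num
  · have h1 : (50 : ℝ) ≤ √n := by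
      refine Real.le_sqrt_of_sq_le ?_
      have : (2500 : ℝ) ≤ n := by exact_mod_cast not_lt.1 h
      linarith
    exact ⟨by positivity, by rw [div_lt_one] <;> linarith⟩

lemma testerAccuracy_le {n : ℕ} (hn : 0 < n) : testerAccuracy n ≤ 200 * (1 / (4 * √n)) := by
  have hs : 0 < √(n : ℝ) := Real.sqrt_pos.2 (Nat.cast_pos.2 hn)
  have h200 : 200 * (1 / (4 * √(n : ℝ))) = 50 / √n := by field_simp; norm_num
  rw [h200]
  unfold testerAccuracy
  split_ifs with h
  · have h1 : √(n : ℝ) ≤ 50 := by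
      refine Real.sqrt_le_iff.2 ⟨by norm_num, ?_⟩
      have : (n : ℝ) < 2500 := by exact_mod_cast h
      linarith
    rw [le_div_iff₀ hs]
    linarith
  · gcongr
    norm_num

lemma measurable_testerRule {n : ℕ} (hn : 0 < n) : Measurable (RealRAM.testerRule hn) := by
  unfold RealRAM.testerRule
  split_ifs
  · exact measurable_oneSampleRule hn
  · exact measurable_gridRule n

lemma solvesCalibrationTesting_testerRule {n : ℕ} (hn : 0 < n) :
    SolvesCalibrationTesting n (testerAccuracy n)
      (Kernel.deterministic (RealRAM.testerRule hn) (measurable_testerRule hn)) := by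
  by_cases h : n < 2500
  · have h1 : RealRAM.testerRule hn = oneSampleRule hn := if_pos h
    simp only [h1, testerAccuracy, if_pos h]
    exact solvesCalibrationTesting_oneSampleRule hn
  · have h1 : RealRAM.testerRule hn = gridRule := if_neg h
    simp only [h1, testerAccuracy, if_neg h]
    exact solvesCalibrationTesting_gridRule hn

/-- The bisections take time `O(n log n)`, within the bound `O(n log² n)`. -/
lemma isBigO_time :
    (fun n : ℕ => ((n * (10 * n.size + 20) + 12 * n + 50 : ℕ) : ℝ)) =O[Filter.atTop]
      fun n : ℕ => (n : ℝ) * Real.log (n : ℝ) ^ 2 := by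
  refine Asymptotics.IsBigO.of_bound 200 ?_
  filter_upwards [Filter.eventually_ge_atTop 3] with n hn
  have hn3 : (3 : ℝ) ≤ n := by exact_mod_cast hn
  have hlog1 : 1 ≤ Real.log n := by
    rw [Real.le_log_iff_exp_le (by linarith)]
    linarith [Real.exp_one_lt_d9]
  have hsize : (n.size : ℝ) ≤ 2 * Real.log n + 1 := by
    have h1 : 2 ^ (n.size - 1) ≤ n := by
      rw [← Nat.lt_size]
      have := Nat.size_pos.2 (by omega : 0 < n)
      omega
    have h2 : ((n.size - 1 : ℕ) : ℝ) * Real.log 2 ≤ Real.log n := by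
      rw [← Real.log_pow]
      exact Real.log_le_log (by positivity) (by exact_mod_cast h1)
    have h3 : (n.size : ℝ) ≤ ((n.size - 1 : ℕ) : ℝ) + 1 := by
      exact_mod_cast (by omega : n.size ≤ n.size - 1 + 1)
    have h4 := Real.log_two_gt_d9
    have h5 : (0 : ℝ) ≤ ((n.size - 1 : ℕ) : ℝ) := Nat.cast_nonneg _
    nlinarith
  rw [Real.norm_of_nonneg (Nat.cast_nonneg _), Real.norm_of_nonneg (by positivity)]
  push_cast
  have h1 : Real.log n ≤ Real.log n ^ 2 := by nlinarith
  have h2 : 10 * (n.size : ℝ) + 20 + 12 + 50 ≤ 200 * Real.log n ^ 2 := by linarith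
  have h3 := mul_le_mul_of_nonneg_left h2 (by linarith : (0 : ℝ) ≤ n)
  nlinarith

/-- For some `ε = Θ(ε_n)`, a single deterministic real RAM program, with words of `O(log n)` bits,
solves the `ε`-calibration testing problem with `n` samples in worst-case time `O(n log² n)`. -/
theorem mainTheorem3 :
    ∃ (c C : ℝ) (ε : ℕ → ℝ) (p : RealRAM.Program) (k : ℕ) (T : ℕ → ℕ),
      0 < c ∧ 0 < C ∧ 1 ≤ k ∧
      (fun n : ℕ => (T n : ℝ)) =O[Filter.atTop] (fun n : ℕ => (n : ℝ) * Real.log (n : ℝ) ^ 2) ∧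
      ∀ n : ℕ, 1 ≤ n →
        testingThreshold n ∈ Set.Ioo (0 : ℝ) 1 ∧
        ε n ∈ Set.Icc (0 : ℝ) 1 ∧
        c * testingThreshold n ≤ ε n ∧ ε n ≤ C * testingThreshold n ∧
        ∃ (f : (Fin n → Sample) → Bool) (hf : Measurable f),
          (∀ x : Fin n → Sample, RealRAM.AnswersWithin (k * Nat.size n) p x (T n) (f x)) ∧
          SolvesCalibrationTesting n (ε n) (Kernel.deterministic f hf) := by
  refine ⟨1, 200, testerAccuracy, RealRAM.testerProgram, 12,
    fun n => n * (10 * n.size + 20) + 12 * n + 50, one_pos, by norm_num, by norm_num, isBigO_time,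
    fun n hn => ?_⟩
  have hmem := testerAccuracy_mem n
  have hle := testingThreshold_le hmem (solvesCalibrationTesting_testerRule hn)
  have hge := le_testingThreshold hn
  have hs : 0 < √(n : ℝ) := Real.sqrt_pos.2 (Nat.cast_pos.2 hn)
  refine ⟨⟨lt_of_lt_of_le (by positivity) hge, hle.trans_lt hmem.2⟩, ⟨hmem.1.le, hmem.2.le⟩,
    by rwa [one_mul], (testerAccuracy_le hn).trans (mul_le_mul_of_nonneg_left hge (by norm_num)),
    RealRAM.testerRule hn, measurable_testerRule hn,
    fun x => RealRAM.answersWithin_testerProgram x hn, solvesCalibrationTesting_testerRule hn⟩
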